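/- Let $G$ be a compact metrizable abelian group with Borel $\sigma$-algebra $\mathcal B(G)$ and normalized Haar measure $\lambda$, let $\Gamma$ be its dual group (the continuous characters of $G$), and let $\Lambda\subset\Gamma$ be an arbitrary subset. For a complex Banach space $X$, let $M(G,X)$ be the set of countably additive $X$-valued measures of bounded variation on $\mathcal B(G)$, let $|\mu|$ denote the variation of $\mu$, and put $$M^\infty(G,X)=\{\mu\in M(G,X):\ |\mu|\le C\lambda\ \text{for some } C>0\}.$$ For $f\in L^1(G,X)$ (Bochner space with respect to $\lambda$) and $\mu\in M(G,X)$ write $\hat f(\gamma)=\int_G\bar\gamma f\,d\lambda$ and $\hat\mu(\gamma)=\int_G\bar\gamma\,d\mu$ for $\gamma\in\Gamma$. The subscript $\Lambda$ on $L^p(G,X)$, $M(G,X)$, $M^\infty(G,X)$ denotes the subset of those elements whose Fourier transform vanishes at every $\gamma\in\Gamma\setminus\Lambda$, and $M_{\Lambda,ac}(G,X)$ denotes the set of those $\mu\in M_\Lambda(G,X)$ that are absolutely continuous with respect to $\lambda$. Identifying a function $f$ with the measure $A\mapsto\int_A f\,d\lambda$, one says that $X$ has the type I-$\Lambda$-RNP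 if $M^\infty_\Lambda(G,X)=L^\infty_\Lambda(G,X)$, and the type II-$\Lambda$-RNP if $M_{\Lambda,ac}(G,X)=L^1_\Lambda(G,X)$. Let $X$ be a complex Banach space, and let $\ell^1[X]$ be the Banach space of all weakly unconditionally Cauchy series in $X$, i.e. of all sequences $(x_n)$ in $X$ with $\sum_{n}|x^*(x_n)|<\infty$ for every $x^*\in X^*$, normed by $$\|(x_n)\|=\sup\Big\{\sum_{n=1}^\infty|x^*(x_n)|:\ x^*\in X^*,\ \|x^*\|\le 1\Big\}.$$ If $X$ has the type I-$\Lambda$-RNP, then $\ell^1[X]$ has the type I-$\Lambda$-RNP. If $X$ has the type II-$\Lambda$-RNP, then $\ell^1[X]$ has the type II-$\Lambda$-RNP. -/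

import Mathlib

open MeasureTheory

open scoped ENNReal NNReal ComplexConjugate

noncomputable section

/-! ### Fourier analysis of vector measures on a compact abelian group -/

namespace LambdaRNP

section

variable (G : Type*) [CommGroup G] [TopologicalSpace G] [IsTopologicalGroup G] [CompactSpace G]
  [MeasurableSpace G] [BorelSpace G]

/-- The Haar measure of a compact group, normalized by giving the whole group mass `1`. -/
def haar : Measure G := Measure.haarMeasure ⊤

variable (X : Type*) [NormedAddCommGroup X] [NormedSpace ℂ X]

variable {G X}

/-- The Fourier coefficient `∫ conj γ • f dλ` (a Bochner integral) of a function `f : G → X`. -/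
def fourierFun (f : G → X) (γ : PontryaginDual G) : X :=
  ∫ t, conj (γ t : ℂ) • f t ∂(haar G)

/-- The Fourier coefficient `∫ conj γ dμ` of an `X`-valued measure `μ`: the integral of a complex
function against `μ`, paired with `μ` by the multiplication of vectors by complex scalars. -/
def fourierMeas (μ : VectorMeasure G X) (γ : PontryaginDual G) : X :=
  μ.integral (fun t => conj (γ t : ℂ)) (ContinuousLinearMap.lsmul ℝ ℂ)

variable (G X)

/-- `M(G, X)`: the countably additive `X`-valued Borel measures of bounded variation. -/
def M : Set (VectorMeasure G X) := {μ | μ.variation Set.univ < ∞}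

/-- `M^∞(G, X)`: the measures `μ` in `M(G, X)` with `|μ| ≤ C λ` for some constant `C > 0`. -/
def MInfty : Set (VectorMeasure G X) :=
  {μ | μ ∈ M G X ∧ ∃ C : ℝ≥0, 0 < C ∧ μ.variation ≤ C • haar G}

variable {G}

/-- `M_Λ(G, X)`: the measures in `M(G, X)` whose Fourier transform vanishes outside `Λ`. -/
def MSpec (Λ : Set (PontryaginDual G)) : Set (VectorMeasure G X) :=
  {μ | μ ∈ M G X ∧ ∀ γ, γ ∉ Λ → fourierMeas μ γ = 0}

/-- `M_Λ^∞(G, X)`: the measures in `M^∞(G, X)` whose Fourier transform vanishes outside `Λ`. -/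
def MInftySpec (Λ : Set (PontryaginDual G)) : Set (VectorMeasure G X) :=
  {μ | μ ∈ MInfty G X ∧ ∀ γ, γ ∉ Λ → fourierMeas μ γ = 0}

/-- `M_{Λ,ac}(G, X)`: the measures in `M_Λ(G, X)` that are absolutely continuous with respect to
Haar measure. -/
def MSpecAC (Λ : Set (PontryaginDual G)) : Set (VectorMeasure G X) :=
  {μ | μ ∈ MSpec X Λ ∧ μ ≪ᵥ (haar G).toENNRealVectorMeasure}

/-- `L^p_Λ(G, X)`: the functions in the Bochner space `L^p(G, X)` whose Fourier transform vanishes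
outside `Λ`. -/
def LSpec (p : ℝ≥0∞) (Λ : Set (PontryaginDual G)) : Set (G → X) :=
  {f | MemLp f p (haar G) ∧ ∀ γ, γ ∉ Λ → fourierFun f γ = 0}

/-- A Banach space `X` has the type I-`Λ`-Radon-Nikodym property if
`M_Λ^∞(G, X) = L_Λ^∞(G, X)`, a function `f` being identified with the measure `f dλ`. -/
def TypeIRNP (Λ : Set (PontryaginDual G)) [CompleteSpace X] : Prop :=
  MInftySpec X Λ = (fun f : G → X => (haar G).withDensityᵥ f) '' LSpec X ∞ Λ

/-- A Banach space `X` has the type II-`Λ`-Radon-Nikodym property if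
`M_{Λ,ac}(G, X) = L_Λ^1(G, X)`, a function `f` being identified with the measure `f dλ`. -/
def TypeIIRNP (Λ : Set (PontryaginDual G)) [CompleteSpace X] : Prop :=
  MSpecAC X Λ = (fun f : G → X => (haar G).withDensityᵥ f) '' LSpec X 1 Λ

end

end LambdaRNP

/-! ### The space of weakly unconditionally Cauchy series -/

section

variable (X : Type*) [NormedAddCommGroup X] [NormedSpace ℂ X]

/-- The vector space of all sequences `x` in `X` for which the series `∑ x n` is weakly
unconditionally Cauchy: `∑ |f (x n)| < ∞` for every `f` in the dual of `X`. -/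
def wucSubmodule : Submodule ℂ (ℕ → X) where
  carrier := {x | ∀ f : StrongDual ℂ X, Summable fun n => ‖f (x n)‖}
  zero_mem' := by intro f; simp
  add_mem' := by
    intro x y hx hy f
    refine Summable.of_nonneg_of_le (fun _ => norm_nonneg _) (fun n => ?_) ((hx f).add (hy f))
    simpa using norm_add_le (f (x n)) (f (y n))
  smul_mem' := by
    intro c x hx f
    simpa [norm_mul] using (hx f).mul_left ‖c‖

/-- `ℓ¹[X]`: the space of all weakly unconditionally Cauchy series in `X`. -/
def WUCSeries : Type _ := wucSubmodule X

variable {X}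

namespace WUCSeries

instance : AddCommGroup (WUCSeries X) := inferInstanceAs (AddCommGroup (wucSubmodule X))

instance : Module ℂ (WUCSeries X) := inferInstanceAs (Module ℂ (wucSubmodule X))

/-- The terms of the series. -/
instance : CoeFun (WUCSeries X) (fun _ => ℕ → X) := ⟨fun x => x.1⟩

/-- The norm `‖x‖ = sup {∑ |f (x n)| : ‖f‖ ≤ 1}`. -/
instance : Norm (WUCSeries X) :=
  ⟨fun x => ⨆ f : {f : StrongDual ℂ X // ‖f‖ ≤ 1}, ∑' n, ‖f.1 (x n)‖⟩

theorem norm_def (x : WUCSeries X) :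
    ‖x‖ = ⨆ f : {f : StrongDual ℂ X // ‖f‖ ≤ 1}, ∑' n, ‖f.1 (x n)‖ := rfl

@[ext] theorem ext {x y : WUCSeries X} (h : ∀ n, x n = y n) : x = y := Subtype.ext (funext h)

@[simp] theorem zero_apply (n : ℕ) : (0 : WUCSeries X) n = 0 := rfl

@[simp] theorem add_apply (x y : WUCSeries X) (n : ℕ) : (x + y) n = x n + y n := rfl

@[simp] theorem sub_apply (x y : WUCSeries X) (n : ℕ) : (x - y) n = x n - y n := rfl

@[simp] theorem smul_apply (c : ℂ) (x : WUCSeries X) (n : ℕ) : (c • x) n = c • x n := rfl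

theorem summable (x : WUCSeries X) (f : StrongDual ℂ X) : Summable fun n => ‖f (x n)‖ := x.2 f

/-- The supremum in the definition of the norm is finite. -/
theorem exists_bound (x : WUCSeries X) :
    ∃ C : ℝ, ∀ f : StrongDual ℂ X, ∑' n, ‖f (x n)‖ ≤ C * ‖f‖ := by
  have mem : ∀ f : StrongDual ℂ X, Memℓp (fun n => f (x n)) 1 := by
    intro f
    refine memℓp_gen ?_
    simpa using x.summable f
  let T : StrongDual ℂ X →ₗ[ℂ] lp (fun _ : ℕ => ℂ) 1 :=
    { toFun := fun f => ⟨fun n => f (x n), mem f⟩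
      map_add' := fun f g => by ext n; rfl
      map_smul' := fun c f => by ext n; simp }
  have hT : Continuous T := by
    refine T.continuous_of_seq_closed_graph ?_
    intro u f g hu hTu
    ext n
    have h1 : Filter.Tendsto (fun k => u k (x n)) Filter.atTop (nhds (f (x n))) :=
      ((ContinuousLinearMap.apply ℂ ℂ (x n)).continuous.tendsto f).comp hu
    have h2 : Filter.Tendsto (fun k => u k (x n)) Filter.atTop (nhds (g n)) := by
      rw [tendsto_iff_norm_sub_tendsto_zero] at hTu ⊢
      refine squeeze_zero (fun _ => norm_nonneg _) (fun k => ?_) hTu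
      exact lp.norm_apply_le_norm one_ne_zero (T (u k) - g) n
    exact tendsto_nhds_unique h2 h1
  let T' : StrongDual ℂ X →L[ℂ] lp (fun _ : ℕ => ℂ) 1 := ⟨T, hT⟩
  refine ⟨‖T'‖, fun f => ?_⟩
  have := T'.le_opNorm f
  rw [lp.norm_eq_tsum_rpow (by simp)] at this
  simpa [T', T] using this

theorem bddAbove (x : WUCSeries X) :
    BddAbove (Set.range fun f : {f : StrongDual ℂ X // ‖f‖ ≤ 1} => ∑' n, ‖f.1 (x n)‖) := by
  obtain ⟨C, hC⟩ := x.exists_bound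
  refine ⟨|C|, ?_⟩
  rintro _ ⟨f, rfl⟩
  calc _ ≤ C * ‖f.1‖ := hC f.1
    _ ≤ |C| * 1 := by gcongr; exacts [le_abs_self C, f.2]
    _ = |C| := mul_one _

theorem tsum_le_norm (x : WUCSeries X) (f : StrongDual ℂ X) (hf : ‖f‖ ≤ 1) :
    ∑' n, ‖f (x n)‖ ≤ ‖x‖ :=
  le_ciSup x.bddAbove (⟨f, hf⟩ : {f : StrongDual ℂ X // ‖f‖ ≤ 1})

theorem norm_le {x : WUCSeries X} {C : ℝ}
    (h : ∀ f : StrongDual ℂ X, ‖f‖ ≤ 1 → ∑' n, ‖f (x n)‖ ≤ C) : ‖x‖ ≤ C := by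
  have : Nonempty {f : StrongDual ℂ X // ‖f‖ ≤ 1} := ⟨⟨0, by simp⟩⟩
  exact ciSup_le fun f => h f.1 f.2

theorem norm_apply_le (x : WUCSeries X) (n : ℕ) : ‖x n‖ ≤ ‖x‖ := by
  obtain ⟨f, hf, hfx⟩ := exists_dual_vector'' ℂ (x n)
  have h := (x.summable f).le_tsum n (fun _ _ => norm_nonneg _)
  have h2 := x.tsum_le_norm f hf
  rw [hfx] at h
  simp only [RCLike.norm_ofReal, abs_norm] at h
  exact h.trans h2

theorem core : NormedSpace.Core ℂ (WUCSeries X) where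
  norm_nonneg x := (norm_nonneg _).trans (x.norm_apply_le 0)
  norm_smul c x := by
    have h : ∀ f : StrongDual ℂ X, ∑' n, ‖f ((c • x) n)‖ = ‖c‖ * ∑' n, ‖f (x n)‖ := by
      intro f
      rw [← tsum_mul_left]
      simp
    rw [norm_def, norm_def, Real.mul_iSup_of_nonneg (norm_nonneg c)]
    simp only [h]
  norm_triangle x y := by
    refine norm_le fun f hf => ?_
    calc ∑' n, ‖f ((x + y) n)‖ ≤ ∑' n, (‖f (x n)‖ + ‖f (y n)‖) := by
          refine Summable.tsum_le_tsum (fun n => ?_) ((x + y).summable f)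
            ((x.summable f).add (y.summable f))
          simpa using norm_add_le (f (x n)) (f (y n))
      _ = ∑' n, ‖f (x n)‖ + ∑' n, ‖f (y n)‖ := (x.summable f).tsum_add (y.summable f)
      _ ≤ ‖x‖ + ‖y‖ := add_le_add (x.tsum_le_norm f hf) (y.tsum_le_norm f hf)
  norm_eq_zero_iff x := by
    constructor
    · intro h
      ext n
      simpa [h] using x.norm_apply_le n
    · rintro rfl
      refine le_antisymm (norm_le fun f _ => by simp) ?_
      exact (norm_nonneg _).trans ((0 : WUCSeries X).norm_apply_le 0)

instance : NormedAddCommGroup (WUCSeries X) := NormedAddCommGroup.ofCore core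

instance : NormedSpace ℂ (WUCSeries X) := NormedSpace.ofCore core

/-- `ℓ¹[X]` is a Banach space if `X` is one. -/
instance [CompleteSpace X] : CompleteSpace (WUCSeries X) := by
  refine Metric.complete_of_cauchySeq_tendsto fun u hu => ?_
  have hc : ∀ n, ∃ y, Filter.Tendsto (fun k => u k n) Filter.atTop (nhds y) := by
    intro n
    refine cauchySeq_tendsto_of_complete ?_
    rw [Metric.cauchySeq_iff] at hu ⊢
    intro ε hε
    obtain ⟨N, hN⟩ := hu ε hε
    refine ⟨N, fun k hk l hl => ?_⟩
    refine lt_of_le_of_lt ?_ (hN k hk l hl)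
    rw [dist_eq_norm, dist_eq_norm]
    exact (u k - u l).norm_apply_le n
  choose y hy using hc
  have key : ∀ ε > 0, ∃ N, ∀ k ≥ N, ∀ f : StrongDual ℂ X, ‖f‖ ≤ 1 → ∀ s : Finset ℕ,
      ∑ n ∈ s, ‖f (u k n - y n)‖ ≤ ε := by
    intro ε hε
    obtain ⟨N, hN⟩ := Metric.cauchySeq_iff.1 hu ε hε
    refine ⟨N, fun k hk f hf s => ?_⟩
    have hlim : Filter.Tendsto (fun l => ∑ n ∈ s, ‖f (u k n - u l n)‖) Filter.atTop
        (nhds (∑ n ∈ s, ‖f (u k n - y n)‖)) :=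
      tendsto_finsetSum _ fun n _ =>
        ((f.continuous.tendsto _).comp (tendsto_const_nhds.sub (hy n))).norm
    refine le_of_tendsto hlim (Filter.eventually_atTop.2 ⟨N, fun l hl => ?_⟩)
    have h1 := ((u k - u l).summable f).sum_le_tsum s (fun _ _ => norm_nonneg _)
    have h2 := (u k - u l).tsum_le_norm f hf
    have h3 := hN k hk l hl
    rw [dist_eq_norm] at h3
    exact (h1.trans h2).trans h3.le
  have hmem : y ∈ wucSubmodule X := by
    obtain ⟨N, hN⟩ := key 1 one_pos
    have hd : u N - y ∈ wucSubmodule X := by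
      intro f
      have hpos : 0 < ‖f‖ + 1 := by positivity
      have hg : ‖((‖f‖ + 1 : ℝ)⁻¹ : ℂ) • f‖ ≤ 1 := by
        rw [norm_smul, norm_inv]
        have : ‖((‖f‖ : ℂ) + 1)‖ = ‖f‖ + 1 := by
          rw [← Complex.ofReal_one, ← Complex.ofReal_add, Complex.norm_real,
            Real.norm_of_nonneg hpos.le]
        push_cast
        rw [this, inv_mul_le_iff₀ hpos]
        linarith
      have hs : Summable fun n => ‖(((‖f‖ + 1 : ℝ)⁻¹ : ℂ) • f) (u N n - y n)‖ :=
        summable_of_sum_le (fun _ => norm_nonneg _) (hN N le_rfl _ hg)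
      have hs' : Summable fun n => ‖((‖f‖ + 1 : ℝ)⁻¹ : ℂ)‖ * ‖f (u N n - y n)‖ := by
        simpa only [_root_.smul_apply, norm_smul] using hs
      refine (summable_mul_left_iff ?_).1 hs'
      rw [norm_ne_zero_iff]
      exact inv_ne_zero (by exact_mod_cast hpos.ne')
    have := (wucSubmodule X).sub_mem (u N).2 hd
    simpa using this
  let z : WUCSeries X := (⟨y, hmem⟩ : wucSubmodule X)
  refine ⟨z, ?_⟩
  rw [Metric.tendsto_atTop]
  intro ε hε
  obtain ⟨N, hN⟩ := key (ε / 2) (half_pos hε)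
  refine ⟨N, fun k hk => ?_⟩
  rw [dist_eq_norm]
  refine lt_of_le_of_lt (norm_le fun f hf => ?_) (half_lt_self hε)
  exact Real.tsum_le_of_sum_le (fun _ => norm_nonneg _) (hN k hk f hf)

end WUCSeries

end

end

noncomputable section

/-! ### Characters of commutative star subalgebras -/

/-! Work coordinatewise. If `μ` is an `ℓ¹[X]`-valued measure with spectrum in `Λ`, its coordinate
measures inherit the spectrum and the size conditions, so by hypothesis they have densities `F n`.
The only candidate for a density of `μ` is `f t = (F n t)_n`. A finite combination `∑ a n • F n`
with `‖a n‖ ≤ 1` is the density of the image of `μ` under a contraction, so its norm is at most `r =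
d|μ|/dλ` almost everywhere. A countable dense set of coefficients gives one null set for all `a`,
and then `f t` lies in `ℓ¹[X]` with norm at most `r t`.

What remains is strong measurability, since `f` need not be separably valued a priori. It holds if
the terms of every weakly unconditionally Cauchy series in `X` tend to zero: a gliding hump then
makes tails uniformly small, and `f` is a pointwise norm limit of its truncations
(`hasDensity_of_termsTendToZero`).

For infinite `Λ` this condition follows from the type I property. Given such a series `x` and
distinct characters `γ n` in `Λ`, the measure `A ↦ ∑ (∫_A γ n dλ) x n` lies in `M_Λ^∞` and has
coefficient `x n` at `γ n`. It has a density, and the Riemann-Lebesgue lemma gives `x n → 0`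
(`termsTendToZero_of_typeIRNP`).

For finite `Λ` the density is the trigonometric polynomial `∑ μ̂(γ) γ`. This is checked in each
coordinate by uniqueness of Fourier coefficients, which rests on characters separating points
(`exists_pontryaginDual_apply_ne_one`). Separation is obtained from Gelfand theory for the
C*-algebra generated by translations and one convolution on `L²(G)`. -/

/-- In the closed star subalgebra generated by a commuting, star-commuting set, every nonzero
element is detected by a character. -/
theorem StarSubalgebra.exists_starAlgHom_apply_ne_zero {B : Type*} [CStarAlgebra B] {s : Set B}
    (hs : ∀ a ∈ s, ∀ b ∈ s, a * b = b * a) (hs' : ∀ a ∈ s, ∀ b ∈ s, a * star b = star b * a)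
    (a : (StarAlgebra.adjoin ℂ s).topologicalClosure) (ha : a ≠ 0) :
    ∃ φ : (StarAlgebra.adjoin ℂ s).topologicalClosure →⋆ₐ[ℂ] ℂ, φ a ≠ 0 := by
  let A := (StarAlgebra.adjoin ℂ s).topologicalClosure
  have hcl : IsClosed (A : Set B) := StarSubalgebra.isClosed_topologicalClosure _
  have hcomm := StarAlgebra.isMulCommutative_adjoin ℂ hs hs'
  let R : CommRing A := StarSubalgebra.commRingTopologicalClosure _ (fun x y => hcomm.1.1 x y)
  let I : CommCStarAlgebra A :=
    { StarSubalgebra.cstarAlgebra A with mul_comm := R.mul_comm }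
  -- The Gelfand transform of a commutative C*-algebra is isometric, so a nonzero element is nonzero
  -- at some character.
  have hinj := (gelfandTransform_isometry A).injective
  have h : WeakDual.gelfandTransform ℂ A a ≠ 0 := fun h => ha (hinj (h.trans (map_zero _).symm))
  obtain ⟨φ, hφ⟩ : ∃ φ, WeakDual.gelfandTransform ℂ A a φ ≠ 0 := by
    by_contra! h'
    exact h (ContinuousMap.ext h')
  exact ⟨{ WeakDual.CharacterSpace.toAlgHom φ with map_star' := map_star φ }, hφ⟩

namespace LambdaRNP

variable {G : Type*} [CommGroup G] [TopologicalSpace G] [IsTopologicalGroup G] [CompactSpace G]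
  [MeasurableSpace G] [BorelSpace G]

instance : (haar G).IsHaarMeasure := inferInstanceAs (Measure.haarMeasure ⊤).IsHaarMeasure

instance : (haar G).Regular := inferInstanceAs (Measure.haarMeasure ⊤).Regular

instance : IsProbabilityMeasure (haar G) :=
  ⟨by simpa using! Measure.haarMeasure_self (G := G) (K₀ := ⊤)⟩

/-! ### Translation and convolution operators on `L²(G)` -/

variable (G) in
/-- The Hilbert space `L²(G)`. -/
abbrev L2 : Type _ := Lp ℂ 2 (haar G)

/-- Translation by `s` on `L²(G)`. -/
def translate (s : G) : L2 G →ₗᵢ[ℂ] L2 G :=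
  Lp.compMeasurePreservingₗᵢ ℂ (s * ·) (measurePreserving_mul_left (haar G) s)

/-- The proof of measure preservation depends on the map, so equal maps are exchanged here by
substitution rather than by rewriting. -/
theorem translate_eq_of_eq {s : G} {h : G → G} (hh : (s * ·) = h)
    (hm : MeasurePreserving h (haar G) (haar G)) (f : L2 G) :
    translate s f = Lp.compMeasurePreserving h hm f := by
  subst hh
  rfl

theorem translate_mul (s t : G) (f : L2 G) :
    translate (s * t) f = translate s (translate t f) := by
  have h : translate (t * s) f = translate s (translate t f) := by
    refine Eq.trans ?_ (Lp.compMeasurePreserving_comp_apply f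
      (measurePreserving_mul_left (haar G) t) (measurePreserving_mul_left (haar G) s))
    exact translate_eq_of_eq (by ext x; simp [mul_assoc]) _ f
  rw [mul_comm, h]

theorem translate_one (f : L2 G) : translate (1 : G) f = f := by
  refine Eq.trans ?_ (Lp.compMeasurePreserving_id_apply f)
  exact translate_eq_of_eq (by ext x; simp) _ f

theorem translate_comm (s t : G) (f : L2 G) :
    translate s (translate t f) = translate t (translate s f) := by
  rw [← translate_mul, mul_comm, translate_mul]

theorem inner_translate (s : G) (f g : L2 G) :
    inner ℂ (translate s f) g = inner ℂ f (translate s⁻¹ g) := by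
  rw [← (translate s).inner_map_map f, ← translate_mul, mul_inv_cancel, translate_one]

/-- This is strong continuity, available because the exponent is finite. Norm continuity fails in
general, which is why convolutions enter below. -/
theorem continuous_translate (f : L2 G) : Continuous fun s : G => translate s f := by
  have : Fact ((2 : ℝ≥0∞) ≠ ∞) := ⟨by simp⟩
  have : Continuous fun s : G => (DomMulAct.mk s) • f :=
    DomMulAct.continuous_mk.smul continuous_const
  exact this

theorem norm_translate (s : G) (f : L2 G) : ‖translate s f‖ = ‖f‖ := (translate s).norm_map f

theorem integrable_smul_translate (k : C(G, ℂ)) (f : L2 G) :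
    Integrable (fun s => k s • translate s f) (haar G) :=
  (k.continuous.smul (continuous_translate f)).integrable_of_hasCompactSupport
    (HasCompactSupport.of_compactSpace _)

theorem norm_integral_smul_translate_le (k : C(G, ℂ)) (f : L2 G) :
    ‖∫ s, k s • translate s f ∂(haar G)‖ ≤ ‖k‖ * ‖f‖ := by
  refine (norm_integral_le_of_norm_le_const (C := ‖k‖ * ‖f‖) (.of_forall fun s => ?_)).trans
    (by simp)
  rw [norm_smul, norm_translate]
  gcongr
  exact k.norm_coe_le_norm s

/-- Convolution by a continuous function, as an average of translations. -/
def convolve (k : C(G, ℂ)) : L2 G →L[ℂ] L2 G :=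
  LinearMap.mkContinuous
    { toFun := fun f => ∫ s, k s • translate s f ∂(haar G)
      map_add' := fun f g => by
        simp only [map_add, smul_add]
        exact integral_add (integrable_smul_translate k f) (integrable_smul_translate k g)
      map_smul' := fun c f => by
        simp only [map_smul, RingHom.id_apply]
        rw [← integral_smul]
        congr with s : 1
        rw [smul_comm] } ‖k‖ (norm_integral_smul_translate_le k)

theorem convolve_apply (k : C(G, ℂ)) (f : L2 G) :
    convolve k f = ∫ s, k s • translate s f ∂(haar G) := rfl

theorem convolve_sub (k l : C(G, ℂ)) : convolve (k - l) = convolve k - convolve l := by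
  ext1 f
  simp only [convolve_apply, _root_.sub_apply, ContinuousMap.sub_apply, sub_smul]
  exact integral_sub (integrable_smul_translate k f) (integrable_smul_translate l f)

theorem norm_convolve_le (k : C(G, ℂ)) : ‖convolve k‖ ≤ ‖k‖ :=
  LinearMap.mkContinuous_norm_le _ (norm_nonneg _) _

theorem continuous_convolve : Continuous (convolve : C(G, ℂ) → L2 G →L[ℂ] L2 G) := by
  refine (LipschitzWith.of_dist_le_mul (K := 1) fun k l => ?_).continuous
  rw [dist_eq_norm, dist_eq_norm, ← convolve_sub, NNReal.coe_one, one_mul]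
  exact norm_convolve_le _

theorem translate_convolve (t : G) (k : C(G, ℂ)) (f : L2 G) :
    translate t (convolve k f) = ∫ s, k s • translate t (translate s f) ∂(haar G) := by
  have := (translate t).toContinuousLinearMap.integral_comp_comm (integrable_smul_translate k f)
  rw [convolve_apply]
  refine this.symm.trans ?_
  simp

theorem convolve_translate (t : G) (k : C(G, ℂ)) (f : L2 G) :
    convolve k (translate t f) = translate t (convolve k f) := by
  rw [translate_convolve, convolve_apply]
  simp only [translate_comm t]

/-- The left translate of a continuous function. -/
def leftTranslate (k : C(G, ℂ)) (t : G) : C(G, ℂ) := ⟨fun s => k (t⁻¹ * s), by fun_prop⟩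

omit [CompactSpace G] [MeasurableSpace G] [BorelSpace G] in
theorem continuous_leftTranslate (k : C(G, ℂ)) : Continuous (leftTranslate k) :=
  (ContinuousMap.curry ⟨fun p : G × G => k (p.1⁻¹ * p.2), by fun_prop⟩).continuous

/-- Invariance of Haar measure moves the translation onto the kernel. The kernel varies continuously
in sup norm, so translation composed with a convolution is norm continuous in `t`. -/
theorem translate_convolve' (t : G) (k : C(G, ℂ)) (f : L2 G) :
    translate t (convolve k f) = convolve (leftTranslate k t) f := by
  rw [translate_convolve, convolve_apply,
    ← integral_mul_left_eq_self (fun s => leftTranslate k t s • translate s f) t]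
  simp [leftTranslate, translate_mul]

/-- The substitution `s ↦ s⁻¹` turns the adjoint into the convolution by `conj (k s⁻¹)`, which is
`k` again by symmetry. Self-adjointness makes the generators commute with each other's adjoints. -/
theorem inner_convolve (k : C(G, ℂ)) (hk : ∀ s, k s⁻¹ = conj (k s)) (f g : L2 G) :
    inner ℂ (convolve k f) g = inner ℂ f (convolve k g) := by
  rw [convolve_apply, convolve_apply, ← integral_inner (integrable_smul_translate k g),
    ← inner_conj_symm, ← integral_inner (integrable_smul_translate k f), ← integral_conj,
    ← integral_inv_eq_self]
  congr with s : 1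
  rw [inner_conj_symm, inner_smul_left, inner_smul_right, inner_translate, hk]
  simp

/-! ### Characters separate points -/

/-- Convolutions with approximate units move a given function arbitrarily little. -/
theorem exists_translate_convolve_ne (x : G) (f : L2 G) (hf : translate x f ≠ f) :
    ∃ k : C(G, ℂ), (∀ s, k s⁻¹ = conj (k s)) ∧ ∃ f, translate x (convolve k f) ≠ convolve k f := by
  have hpos : 0 < ‖translate x f - f‖ := norm_pos_iff.2 (sub_ne_zero.2 hf)
  set ε := ‖translate x f - f‖ / 3 with hε
  obtain ⟨W, hW, hWo, h1W⟩ := mem_nhds_iff.1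
    ((continuous_translate f).continuousAt (x := (1 : G)) (Metric.ball_mem_nhds _
      (by positivity : 0 < ε)))
  obtain ⟨u, hu1, hu0, -, hu01⟩ := exists_continuous_one_zero_of_isCompact
    (isCompact_singleton (x := (1 : G))) hWo.isClosed_compl (by simpa using h1W)
  -- The product makes the kernel symmetric under inversion; it is nonnegative and supported where
  -- translation moves `f` by less than `ε`.
  let k : C(G, ℂ) := ⟨fun s => ((u s * u s⁻¹ : ℝ) : ℂ), by fun_prop⟩
  have hkn : ∀ s, 0 ≤ u s * u s⁻¹ := fun s => mul_nonneg (hu01 s).1 (hu01 _).1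
  have hc : Continuous fun s : G => u s * u s⁻¹ := by fun_prop
  have hci : Integrable (fun s : G => u s * u s⁻¹) (haar G) :=
    hc.integrable_of_hasCompactSupport (HasCompactSupport.of_compactSpace _)
  have hI : 0 < ∫ s, u s * u s⁻¹ ∂(haar G) := by
    refine hc.integral_pos_of_hasCompactSupport_nonneg_nonzero
      (HasCompactSupport.of_compactSpace _) hkn (x := 1) ?_
    simp [hu1 (Set.mem_singleton (1 : G))]
  refine ⟨k, fun s => ?_, f, fun h => ?_⟩
  · simp [k, mul_comm]
  set I := ∫ s, u s * u s⁻¹ ∂(haar G) with hIdef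
  have hclose : ‖convolve k f - (I : ℂ) • f‖ ≤ I * ε := by
    have e1 : (I : ℂ) • f = ∫ s, k s • f ∂(haar G) := by
      rw [integral_smul_const]
      congr 1
      exact (integral_ofReal (𝕜 := ℂ)).symm
    have hki : Integrable (fun s => k s • f) (haar G) :=
      (k.continuous.smul continuous_const).integrable_of_hasCompactSupport
        (HasCompactSupport.of_compactSpace _)
    rw [e1, convolve_apply, ← integral_sub (integrable_smul_translate k f) hki]
    refine (norm_integral_le_of_norm_le (hci.mul_const ε) (.of_forall fun s => ?_)).trans_eq
      (integral_mul_const _ _)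
    rw [← smul_sub, norm_smul]
    have : ‖k s‖ = u s * u s⁻¹ := by
      simpa [k] using abs_of_nonneg (hkn s)
    rw [this]
    by_cases hs : s ∈ W
    · gcongr
      · exact hkn s
      · have := hW hs
        rw [Set.mem_preimage, Metric.mem_ball, dist_eq_norm, translate_one] at this
        exact this.le
    · simp [hu0 hs]
  have h2 : ‖translate x (convolve k f) - (I : ℂ) • translate x f‖ ≤ I * ε := by
    rwa [← map_smul, ← map_sub, norm_translate]
  rw [h] at h2
  -- If `x` fixed `convolve k f`, then `I • f` and its translate would be within `2Iε` of each
  -- other, against `‖translate x f - f‖ = 3ε`.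
  have h3 : ‖(I : ℂ) • (translate x f - f)‖ ≤ I * ε + I * ε := by
    have : (I : ℂ) • (translate x f - f)
        = (convolve k f - (I : ℂ) • f) - (convolve k f - (I : ℂ) • translate x f) := by
      rw [smul_sub]; abel
    rw [this]
    exact (norm_sub_le _ _).trans (add_le_add hclose h2)
  rw [norm_smul, Complex.norm_real, Real.norm_of_nonneg hI.le] at h3
  have : ‖translate x f - f‖ ≤ ε + ε := by
    rw [← mul_add] at h3
    exact le_of_mul_le_mul_left h3 hI
  linarith

/-- Haar measure charges open sets, so continuous functions agreeing almost everywhere agree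
everywhere; a function equal to `1` at `1` and `0` at `x` is therefore moved by `x`. -/
theorem exists_translate_ne [T2Space G] {x : G} (hx : x ≠ 1) : ∃ f : L2 G, translate x f ≠ f := by
  obtain ⟨u, hu1, hu0, -⟩ := exists_continuous_one_zero_of_isCompact
    (isCompact_singleton (x := (1 : G))) (isClosed_singleton (x := x)) (by simpa using hx.symm)
  let v : C(G, ℂ) := ⟨fun s => (u s : ℂ), by fun_prop⟩
  have hv : MemLp v 2 (haar G) := v.continuous.memLp_of_hasCompactSupport
    (HasCompactSupport.of_compactSpace _)
  refine ⟨hv.toLp v, fun h => ?_⟩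
  have h1 : (translate x (hv.toLp v) : G → ℂ) =ᵐ[haar G] fun s => v (x * s) :=
    (Lp.coeFn_compMeasurePreserving _ (measurePreserving_mul_left (haar G) x)).trans
      ((measurePreserving_mul_left (haar G) x).quasiMeasurePreserving.ae_eq_comp hv.coeFn_toLp)
  rw [h] at h1
  have h2 := (h1.symm.trans hv.coeFn_toLp)
  have h3 := Continuous.ae_eq_iff_eq (haar G) (by fun_prop) v.continuous |>.1 h2
  have h4 := congr_fun h3 1
  simp [v, hu1 (Set.mem_singleton (1 : G)), hu0 (Set.mem_singleton x)] at h4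

omit [CompactSpace G] [MeasurableSpace G] [BorelSpace G] [IsTopologicalGroup G] in
/-- A continuous homomorphism into the complex numbers of modulus one is a character. -/
theorem exists_pontryaginDual_coe_eq {ψ : G → ℂ} (h1 : ψ 1 = 1)
    (hmul : ∀ s t, ψ (s * t) = ψ s * ψ t) (hnorm : ∀ s, ‖ψ s‖ = 1) (hc : Continuous ψ) :
    ∃ γ : PontryaginDual G, ∀ s, (γ s : ℂ) = ψ s := by
  let γ : G →ₜ* Circle :=
    { toFun := fun s => ⟨ψ s, mem_sphere_zero_iff_norm.2 (hnorm s)⟩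
      map_one' := Circle.ext h1
      map_mul' := fun s t => Circle.ext (hmul s t)
      continuous_toFun := Continuous.subtype_mk hc _ }
  exact ⟨γ, fun s => rfl⟩

/-- The continuous characters of a compact abelian group separate its points. -/
theorem exists_pontryaginDual_apply_ne_one [T2Space G] {x : G} (hx : x ≠ 1) :
    ∃ γ : PontryaginDual G, γ x ≠ 1 := by
  obtain ⟨f₀, hf₀⟩ := exists_translate_ne hx
  obtain ⟨k, hk, f, hf⟩ := exists_translate_convolve_ne x f₀ hf₀
  let U : G → L2 G →L[ℂ] L2 G := fun s => (translate s).toContinuousLinearMap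
  let T : L2 G →L[ℂ] L2 G := convolve k
  have hU : ∀ s t, U (s * t) = U s * U t := fun s t => by
    ext1 f; exact translate_mul s t f
  have hU1 : U 1 = 1 := by ext1 f; exact translate_one f
  have hUT : ∀ s, U s * T = T * U s := fun s => by
    ext1 f; exact (convolve_translate s k f).symm
  have hUU : ∀ s t, U s * U t = U t * U s := fun s t => by rw [← hU, mul_comm, hU]
  have hUstar : ∀ s, star (U s) = U s⁻¹ := fun s => by
    rw [ContinuousLinearMap.star_eq_adjoint, eq_comm, ContinuousLinearMap.eq_adjoint_iff]
    intro f g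
    exact (inner_translate s⁻¹ f g).trans (by rw [inv_inv]; rfl)
  have hTstar : star T = T := by
    rw [ContinuousLinearMap.star_eq_adjoint, eq_comm, ContinuousLinearMap.eq_adjoint_iff]
    exact inner_convolve k hk
  let S : Set (L2 G →L[ℂ] L2 G) := insert T (Set.range U)
  have hS : ∀ a ∈ S, ∀ b ∈ S, a * b = b * a := by
    rintro _ (rfl | ⟨s, rfl⟩) _ (rfl | ⟨t, rfl⟩)
    · rfl
    · exact (hUT t).symm
    · exact hUT s
    · exact hUU s t
  have hS' : ∀ a ∈ S, ∀ b ∈ S, a * star b = star b * a := by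
    rintro a ha _ (rfl | ⟨t, rfl⟩)
    · rw [hTstar]; exact hS _ ha _ (Or.inl rfl)
    · rw [hUstar]; exact hS _ ha _ (Or.inr ⟨_, rfl⟩)
  have hle := (StarAlgebra.adjoin ℂ S).le_topologicalClosure
  let A := (StarAlgebra.adjoin ℂ S).topologicalClosure
  have hcl : IsClosed (A : Set (L2 G →L[ℂ] L2 G)) := StarSubalgebra.isClosed_topologicalClosure _
  let T' : A := ⟨T, hle (StarAlgebra.subset_adjoin ℂ S (Or.inl rfl))⟩
  let U' : G → A := fun s => ⟨U s, hle (StarAlgebra.subset_adjoin ℂ S (Or.inr ⟨s, rfl⟩))⟩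
  have hU' : ∀ s t, U' (s * t) = U' s * U' t := fun s t => Subtype.ext (hU s t)
  have hU1' : U' 1 = 1 := Subtype.ext hU1
  -- A character nonzero on this product is nonzero on both factors: the first factor separates `x`
  -- from `1`, the second gives continuity.
  have hne : (U' x - 1) * T' ≠ 0 := by
    intro h
    have h1 : (U x - 1) * T = 0 := congr_arg Subtype.val h
    have h2 := congr_arg (fun L : L2 G →L[ℂ] L2 G => L f) h1
    exact hf (sub_eq_zero.1 h2)
  obtain ⟨φ, hφ⟩ := StarSubalgebra.exists_starAlgHom_apply_ne_zero hS hS' _ hne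
  rw [map_mul, map_sub, map_one] at hφ
  have hφT : φ T' ≠ 0 := right_ne_zero_of_mul hφ
  have hφx : φ (U' x) ≠ 1 := fun h => left_ne_zero_of_mul hφ (by rw [h, sub_self])
  have hnorm : ∀ s, ‖φ (U' s)‖ = 1 := by
    intro s
    have h1 : star (U' s) * U' s = 1 := by
      refine Subtype.ext ?_
      change star (U s) * U s = 1
      rw [hUstar, ← hU, inv_mul_cancel, hU1]
    have h2 := congr_arg φ h1
    rw [map_mul, map_star, map_one, Complex.star_def, Complex.conj_mul'] at h2
    have h3 : ‖φ (U' s)‖ ^ 2 = 1 := by exact_mod_cast h2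
    exact (pow_eq_one_iff_of_nonneg (norm_nonneg _) two_ne_zero).1 h3
  have hUT' : Continuous fun s => U' s * T' := by
    refine Continuous.subtype_mk (f := fun s => U s * T) ?_ _
    have : (fun s => U s * T) = fun s => convolve (leftTranslate k s) := by
      funext s
      ext1 f
      exact translate_convolve' s k f
    rw [this]
    exact continuous_convolve.comp (continuous_leftTranslate k)
  have hφc : Continuous φ := map_continuous φ
  -- Dividing by `φ T'` recovers `φ (U' s)` from the norm-continuous family `U' s * T'`.
  have hcont : Continuous fun s => φ (U' s) := by
    have : (fun s => φ (U' s)) = fun s => φ (U' s * T') / φ T' := by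
      funext s
      rw [map_mul, mul_div_cancel_right₀ _ hφT]
    rw [this]
    exact (hφc.comp hUT').div_const _
  obtain ⟨γ, hγ⟩ := exists_pontryaginDual_coe_eq (ψ := fun s => φ (U' s)) (by simp [hU1'])
    (fun s t => by simp [hU']) hnorm hcont
  exact ⟨γ, fun h => hφx (by rw [← hγ, h, Circle.coe_one])⟩

end LambdaRNP

namespace LambdaRNP

variable {G : Type*} [CommGroup G] [TopologicalSpace G] [IsTopologicalGroup G] [CompactSpace G]
  [MeasurableSpace G] [BorelSpace G]

/-! ### Fourier coefficients of Bochner integrable functions -/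

omit [IsTopologicalGroup G] [CompactSpace G] [MeasurableSpace G] [BorelSpace G] in
theorem continuous_coe_char (γ : PontryaginDual G) : Continuous fun t => (γ t : ℂ) :=
  continuous_subtype_val.comp (map_continuous γ)

/-- A character as a continuous complex function. -/
def charMap (γ : PontryaginDual G) : C(G, ℂ) := ⟨fun t => (γ t : ℂ), continuous_coe_char γ⟩

omit [IsTopologicalGroup G] [CompactSpace G] [MeasurableSpace G] [BorelSpace G] in
theorem conj_coe_char (γ : PontryaginDual G) (t : G) : conj (γ t : ℂ) = ((γ⁻¹) t : ℂ) :=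
  (Circle.coe_inv_eq_conj (γ t)).symm

section

variable {X : Type*} [NormedAddCommGroup X] [NormedSpace ℂ X] {f g : G → X}

theorem integrable_char_smul (hf : Integrable f (haar G)) (γ : PontryaginDual G) :
    Integrable (fun t => (γ t : ℂ) • f t) (haar G) := by
  refine hf.norm.mono' ((continuous_coe_char γ).aestronglyMeasurable.smul hf.1)
    (.of_forall fun t => ?_)
  simp [norm_smul, Circle.norm_coe]

theorem integrable_conj_char_smul (hf : Integrable f (haar G)) (γ : PontryaginDual G) :
    Integrable (fun t => conj (γ t : ℂ) • f t) (haar G) := by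
  simp only [conj_coe_char]
  exact integrable_char_smul hf _

theorem fourierFun_add (hf : Integrable f (haar G)) (hg : Integrable g (haar G))
    (γ : PontryaginDual G) : fourierFun (f + g) γ = fourierFun f γ + fourierFun g γ := by
  simp only [fourierFun, Pi.add_apply, smul_add]
  exact integral_add (integrable_conj_char_smul hf γ) (integrable_conj_char_smul hg γ)

theorem fourierFun_sub (hf : Integrable f (haar G)) (hg : Integrable g (haar G))
    (γ : PontryaginDual G) : fourierFun (f - g) γ = fourierFun f γ - fourierFun g γ := by
  simp only [fourierFun, Pi.sub_apply, smul_sub]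
  exact integral_sub (integrable_conj_char_smul hf γ) (integrable_conj_char_smul hg γ)

theorem fourierFun_congr_ae (h : f =ᵐ[haar G] g) (γ : PontryaginDual G) :
    fourierFun f γ = fourierFun g γ := by
  refine integral_congr_ae ?_
  filter_upwards [h] with t ht
  rw [ht]

theorem norm_fourierFun_le (f : G → X) (γ : PontryaginDual G) :
    ‖fourierFun f γ‖ ≤ ∫ t, ‖f t‖ ∂(haar G) := by
  refine (norm_integral_le_integral_norm _).trans_eq ?_
  simp [norm_smul, Circle.norm_coe]

theorem fourierFun_sum {ι : Type*} (s : Finset ι) (F : ι → G → X)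
    (hF : ∀ i ∈ s, Integrable (F i) (haar G)) (γ : PontryaginDual G) :
    fourierFun (fun t => ∑ i ∈ s, F i t) γ = ∑ i ∈ s, fourierFun (F i) γ := by
  simp only [fourierFun, Finset.smul_sum]
  exact integral_finsetSum s fun i hi => integrable_conj_char_smul (hF i hi) γ

/-- A nontrivial character has integral zero. -/
theorem integral_char_of_ne_one {γ : PontryaginDual G} (hγ : γ ≠ 1) :
    ∫ t, (γ t : ℂ) ∂(haar G) = 0 := by
  obtain ⟨s, hs⟩ : ∃ s, γ s ≠ 1 := by
    by_contra! h
    exact hγ (PontryaginDual.ext h)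
  have h := integral_mul_left_eq_self (μ := haar G) (fun t => (γ t : ℂ)) s
  simp only [map_mul, Circle.coe_mul] at h
  rw [integral_const_mul] at h
  have h2 : ((γ s : ℂ) - 1) * ∫ t, (γ t : ℂ) ∂(haar G) = 0 := by rw [sub_mul, h]; ring
  rcases mul_eq_zero.1 h2 with h3 | h3
  · exact absurd (Circle.ext (by simpa [sub_eq_zero] using h3)) hs
  · exact h3

theorem integral_conj_char_mul_char (γ δ : PontryaginDual G) [Decidable (γ = δ)] :
    ∫ t, conj (γ t : ℂ) * (δ t : ℂ) ∂(haar G) = if γ = δ then 1 else 0 := by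
  have h : ∀ t, conj (γ t : ℂ) * (δ t : ℂ) = ((γ⁻¹ * δ) t : ℂ) := fun t => by
    rw [conj_coe_char, ← Circle.coe_mul]; rfl
  simp only [h]
  split_ifs with hγ
  · subst hγ
    simp
  · exact integral_char_of_ne_one fun h => hγ (inv_mul_eq_one.1 h)

theorem fourierFun_char_smul (δ : PontryaginDual G) (x : X) [CompleteSpace X]
    (γ : PontryaginDual G) [Decidable (γ = δ)] :
    fourierFun (fun t => (δ t : ℂ) • x) γ = if γ = δ then x else 0 := by
  simp only [fourierFun, smul_smul]
  rw [integral_smul_const, integral_conj_char_mul_char]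
  split_ifs <;> simp

theorem memLp_char (γ : PontryaginDual G) (p : ℝ≥0∞) :
    MemLp (fun t => (γ t : ℂ)) p (haar G) :=
  (continuous_coe_char γ).memLp_of_hasCompactSupport (HasCompactSupport.of_compactSpace _)

theorem orthonormal_char :
    Orthonormal ℂ fun γ : PontryaginDual G => (memLp_char γ 2).toLp (fun t => (γ t : ℂ)) := by
  classical
  rw [orthonormal_iff_ite]
  intro γ δ
  rw [L2.inner_def, ← integral_conj_char_mul_char γ δ]
  refine integral_congr_ae ?_
  filter_upwards [(memLp_char γ 2).coeFn_toLp, (memLp_char δ 2).coeFn_toLp] with t h1 h2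
  rw [h1, h2, RCLike.inner_apply, mul_comm]

/-- The Riemann-Lebesgue lemma along a sequence of distinct characters. -/
theorem tendsto_fourierFun_zero [CompleteSpace X] (hf : Integrable f (haar G))
    {γ : ℕ → PontryaginDual G} (hγ : Function.Injective γ) :
    Filter.Tendsto (fun n => fourierFun f (γ n)) Filter.atTop (nhds 0) := by
  refine Integrable.induction (μ := haar G)
    (fun f => Filter.Tendsto (fun n => fourierFun f (γ n)) Filter.atTop (nhds 0))
    ?_ ?_ ?_ ?_ hf
  · intro c s hs _
    have hL : MemLp (s.indicator fun _ => (1 : ℂ)) 2 (haar G) :=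
      memLp_indicator_const 2 hs 1 (Or.inr (measure_ne_top _ _))
    -- Bessel's inequality makes the squared coefficients of an indicator summable.
    have h1 := ((orthonormal_char (G := G)).comp γ hγ).inner_products_summable
      (x := hL.toLp _) |>.tendsto_atTop_zero
    have h2 : Filter.Tendsto (fun n => fourierFun (s.indicator fun _ => (1 : ℂ)) (γ n))
        Filter.atTop (nhds 0) := by
      rw [tendsto_zero_iff_norm_tendsto_zero]
      have h3 := h1.sqrt
      simp only [Real.sqrt_sq (norm_nonneg _), Real.sqrt_zero] at h3
      refine h3.congr fun n => ?_
      congr 1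
      rw [L2.inner_def]
      refine integral_congr_ae ?_
      filter_upwards [(memLp_char (γ n) 2).coeFn_toLp, hL.coeFn_toLp] with t h1 h2
      simp only [Function.comp_apply]
      rw [h1, h2, RCLike.inner_apply, smul_eq_mul, mul_comm]
    have h3 := h2.smul_const c
    rw [zero_smul] at h3
    refine h3.congr fun n => ?_
    rw [fourierFun, fourierFun, ← integral_smul_const]
    congr with t
    by_cases ht : t ∈ s <;> simp [ht]
  · intro f g _ hf hg h1 h2
    have := h1.add h2
    rw [add_zero] at this
    exact this.congr fun n => (fourierFun_add hf hg _).symm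
  -- Each coefficient map is a contraction on `L¹`, uniformly in `n`, so the limit survives `L¹`
  -- approximation.
  · refine isClosed_of_closure_subset fun f hf => ?_
    rw [Set.mem_ofPred_eq, Metric.tendsto_atTop]
    intro ε hε
    obtain ⟨g, hg, hfg⟩ := Metric.mem_closure_iff.1 hf (ε / 2) (half_pos hε)
    obtain ⟨N, hN⟩ := Metric.tendsto_atTop.1 hg (ε / 2) (half_pos hε)
    refine ⟨N, fun n hn => ?_⟩
    have h1 := hN n hn
    rw [dist_zero_right] at h1 ⊢
    have h2 : ‖fourierFun f (γ n) - fourierFun g (γ n)‖ < ε / 2 := by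
      rw [← fourierFun_sub (L1.integrable_coeFn f) (L1.integrable_coeFn g)]
      refine (norm_fourierFun_le _ _).trans_lt (lt_of_eq_of_lt ?_ hfg)
      rw [dist_eq_norm, L1.norm_eq_integral_norm]
      refine integral_congr_ae ?_
      filter_upwards [Lp.coeFn_sub f g] with t ht
      rw [ht]
    calc ‖fourierFun f (γ n)‖
        ≤ ‖fourierFun f (γ n) - fourierFun g (γ n)‖ + ‖fourierFun g (γ n)‖ := by
          simpa using norm_add_le (fourierFun f (γ n) - fourierFun g (γ n)) (fourierFun g (γ n))
      _ < ε / 2 + ε / 2 := add_lt_add h2 h1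
      _ = ε := add_halves ε
  · intro f g hfg _ h
    exact h.congr fun n => fourierFun_congr_ae hfg _

end

/-! ### Density of trigonometric polynomials and uniqueness of Fourier coefficients -/

/-- The trigonometric polynomials. -/
def trigSubalgebra (G : Type*) [CommGroup G] [TopologicalSpace G] [IsTopologicalGroup G]
    [CompactSpace G] : StarSubalgebra ℂ C(G, ℂ) where
  toSubalgebra := Algebra.adjoin ℂ (Set.range charMap)
  star_mem' := by
    change Algebra.adjoin ℂ (Set.range charMap) ≤ star (Algebra.adjoin ℂ (Set.range charMap))
    refine Algebra.adjoin_le ?_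
    rintro - ⟨γ, rfl⟩
    exact Algebra.subset_adjoin ⟨γ⁻¹, ContinuousMap.ext fun t => (conj_coe_char γ t).symm⟩

omit [MeasurableSpace G] [BorelSpace G] in
theorem trigSubalgebra_eq_span :
    Subalgebra.toSubmodule (trigSubalgebra G).toSubalgebra =
      Submodule.span ℂ (Set.range (charMap (G := G))) := by
  refine Algebra.adjoin_eq_span_of_subset ℂ (Set.Subset.trans (fun x hx => ?_) Submodule.subset_span)
  refine Submonoid.closure_induction (fun _ => id) ⟨1, ?_⟩ ?_ hx
  · ext t; simp [charMap]
  · rintro - - - - ⟨γ, rfl⟩ ⟨δ, rfl⟩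
    exact ⟨γ * δ, ContinuousMap.ext fun t => Circle.coe_mul (γ t) (δ t)⟩

theorem trigSubalgebra_dense [T2Space G] : (trigSubalgebra G).topologicalClosure = ⊤ := by
  refine ContinuousMap.starSubalgebra_topologicalClosure_eq_top_of_separatesPoints _ ?_
  intro x y hxy
  obtain ⟨γ, hγ⟩ := exists_pontryaginDual_apply_ne_one (x := x * y⁻¹)
    (fun h => hxy (mul_inv_eq_one.1 h))
  refine ⟨_, ⟨charMap γ, Algebra.subset_adjoin ⟨γ, rfl⟩, rfl⟩, fun h => hγ ?_⟩
  rw [map_mul, map_inv, mul_inv_eq_one]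
  exact Circle.ext h

/-- A Bochner integrable function all of whose Fourier coefficients vanish is zero. -/
theorem ae_eq_zero_of_fourierFun_eq_zero [TopologicalSpace.MetrizableSpace G]
    {X : Type*} [NormedAddCommGroup X] [NormedSpace ℂ X] [CompleteSpace X] {f : G → X}
    (hf : Integrable f (haar G)) (h : ∀ γ, fourierFun f γ = 0) : f =ᵐ[haar G] 0 := by
  have hint : ∀ k : C(G, ℂ), Integrable (fun t => k t • f t) (haar G) := fun k =>
    hf.bdd_smul ‖k‖ k.continuous.aestronglyMeasurable
      (.of_forall k.norm_coe_le_norm)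
  let J : C(G, ℂ) →L[ℂ] X := LinearMap.mkContinuous
    { toFun := fun k => ∫ t, k t • f t ∂(haar G)
      map_add' := fun k l => by
        simp only [ContinuousMap.add_apply, add_smul]
        exact integral_add (hint k) (hint l)
      map_smul' := fun c k => by
        simp only [ContinuousMap.smul_apply, smul_assoc, RingHom.id_apply]
        exact integral_smul _ _ } (∫ t, ‖f t‖ ∂(haar G)) (fun k => by
      rw [mul_comm, ← integral_const_mul]
      refine norm_integral_le_of_norm_le (hf.norm.const_mul _) (.of_forall fun t => ?_)
      rw [norm_smul]
      gcongr
      exact k.norm_coe_le_norm t)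
  have hJ : ∀ k, J k = ∫ t, k t • f t ∂(haar G) := fun k => rfl
  -- `J` vanishes on characters, hence on their span, and by density on all of `C(G, ℂ)`.
  have hker : ∀ k, J k = 0 := by
    intro k
    have hk : k ∈ closure ((trigSubalgebra G : Set C(G, ℂ))) := by
      rw [← StarSubalgebra.topologicalClosure_coe, trigSubalgebra_dense]
      trivial
    have hcl : IsClosed {k | J k = 0} := isClosed_eq J.continuous continuous_const
    refine closure_minimal ?_ hcl hk
    intro l hl
    have hl' : l ∈ Submodule.span ℂ (Set.range (charMap (G := G))) := by
      rw [← trigSubalgebra_eq_span]; exact hl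
    refine (Submodule.span_le (p := LinearMap.ker J.toLinearMap)).2 ?_ hl'
    rintro _ ⟨γ, rfl⟩
    have := h γ⁻¹
    simp only [fourierFun, conj_coe_char, inv_inv] at this
    exact this
  let := TopologicalSpace.metrizableSpaceMetric G
  refine ae_eq_zero_of_forall_setIntegral_isClosed_eq_zero hf fun s hs => ?_
  let δ : ℕ → ℝ := fun n => 1 / ((n : ℝ) + 1)
  have hδ : ∀ n, 0 < δ n := fun n => by positivity
  -- Continuous functions converge pointwise to the indicator of a closed set, so dominated
  -- convergence passes from `J = 0` to integrals over closed sets.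
  have hlim := thickenedIndicator_tendsto_indicator_closure hδ
    tendsto_one_div_add_atTop_nhds_zero_nat s
  rw [tendsto_pi_nhds] at hlim
  let k : ℕ → C(G, ℂ) := fun n => ⟨fun t => ((thickenedIndicator (hδ n) s t : ℝ) : ℂ), by fun_prop⟩
  rw [← integral_indicator hs.measurableSet]
  refine tendsto_nhds_unique (tendsto_integral_of_dominated_convergence (fun t => ‖f t‖)
    (F := fun n t => k n t • f t) (fun n => (hint (k n)).1) hf.norm (fun n => .of_forall fun t => ?_)
    (.of_forall fun t => ?_)) ?_
  · rw [norm_smul]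
    refine mul_le_of_le_one_left (norm_nonneg _) ?_
    simpa [k] using thickenedIndicator_le_one (hδ n) s t
  · have h1 := ((Complex.continuous_ofReal.comp NNReal.continuous_coe).tendsto _).comp (hlim t)
    have h2 := h1.smul_const (f t)
    rw [hs.closure_eq] at h2
    have h3 : s.indicator f t = (Complex.ofReal ∘ NNReal.toReal)
        (s.indicator (fun _ => (1 : ℝ≥0)) t) • f t := by
      by_cases ht : t ∈ s <;> simp [ht]
    rw [h3]
    exact h2
  · simp only [← hJ, hker]
    exact tendsto_const_nhds

end LambdaRNP

/-! ### Integrals of complex functions against vector measures -/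

namespace MeasureTheory.VectorMeasure

variable {α : Type*} [MeasurableSpace α] {X Y : Type*} [NormedAddCommGroup X] [NormedSpace ℂ X]
  [NormedAddCommGroup Y] [NormedSpace ℂ Y]

/-- The integral against a vector measure `μ` is the only `L¹`-bounded additive functional with the
values `z • μ s` on the functions `z 1_s`. -/
theorem integral_lsmul_eq_of_additive [CompleteSpace X] {μ : VectorMeasure α X} {m : Measure α}
    [IsFiniteMeasure m] {c : ℝ≥0} (hμ : μ.variation ≤ c • m) {Ψ : (α → ℂ) → X}
    (hadd : ∀ f g, Integrable f m → Integrable g m → Ψ (f + g) = Ψ f + Ψ g)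
    (hind : ∀ s, MeasurableSet s → ∀ z, Ψ (s.indicator fun _ => z) = z • μ s) {K : ℝ}
    (hbound : ∀ g, Integrable g m → ‖Ψ g‖ ≤ K * ∫ t, ‖g t‖ ∂m) {g : α → ℂ} (hg : Integrable g m) :
    μ.integral g (ContinuousLinearMap.lsmul ℝ ℂ) = Ψ g := by
  have hfin : IsFiniteMeasure μ.variation := isFiniteMeasure_of_le _ hμ
  have hint : ∀ {f : α → ℂ}, Integrable f m → μ.Integrable f := fun hf =>
    hf.of_measure_le_smul (by simp) hμ
  set L : ℝ := ‖(ContinuousLinearMap.lsmul ℝ ℂ : ℂ →L[ℝ] X →L[ℝ] X)‖ with hL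
  -- The difference of the two functionals is additive, `L¹`-bounded and zero on indicators, so it
  -- vanishes by density.
  let D : (α → ℂ) → X := fun f => μ.integral f (ContinuousLinearMap.lsmul ℝ ℂ) - Ψ f
  have hDadd : ∀ f g, Integrable f m → Integrable g m → D (f + g) = D f + D g := by
    intro f g hf hg
    simp only [D, hadd f g hf hg]
    rw [VectorMeasure.integral_add (hint hf) (hint hg)]
    abel
  have hDbound : ∀ f, Integrable f m → ‖D f‖ ≤ (L * c + K) * ∫ t, ‖f t‖ ∂m := by
    intro f hf
    refine (norm_sub_le _ _).trans ?_
    rw [add_mul]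
    refine add_le_add ?_ (hbound f hf)
    refine (VectorMeasure.norm_integral_le_integral_norm).trans ?_
    rw [mul_assoc]
    gcongr
    have h1 : ∫ t, ‖f t‖ ∂μ.variation ≤ ∫ t, ‖f t‖ ∂(c • m) :=
      integral_mono_measure hμ (.of_forall fun _ => norm_nonneg _)
        (hf.norm.smul_measure_nnreal)
    exact h1.trans_eq (integral_smul_nnreal_measure _ _)
  suffices h : D g = 0 from sub_eq_zero.1 h
  refine Integrable.induction (μ := m) (fun f => D f = 0) ?_ ?_ ?_ ?_ hg
  · intro z s hs _
    simp only [D, hind s hs, VectorMeasure.integral_indicator_const z hs]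
    simp
  · intro f g _ hf hg h1 h2
    rw [hDadd f g hf hg, h1, h2, add_zero]
  · refine isClosed_of_closure_subset fun f hf => ?_
    rw [Set.mem_ofPred_eq, ← norm_le_zero_iff]
    refine ge_of_tendsto' (x := Filter.atTop)
      (f := fun n : ℕ => (|L * c + K|) * (1 / ((n : ℝ) + 1))) ?_ fun n => ?_
    · simpa using tendsto_one_div_add_atTop_nhds_zero_nat.const_mul (|L * c + K|)
    · obtain ⟨g, hg, hfg⟩ := Metric.mem_closure_iff.1 hf (1 / ((n : ℝ) + 1)) (by positivity)
      have hfi := L1.integrable_coeFn f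
      have hgi := L1.integrable_coeFn g
      have h1 : D f = D (f - g) := by
        have := hDadd (f - g) g (hfi.sub hgi) hgi
        rwa [sub_add_cancel, show D g = 0 from hg, add_zero] at this
      rw [h1]
      refine (hDbound _ (hfi.sub hgi)).trans ?_
      have h2 : ∫ t, ‖((f : α → ℂ) - g) t‖ ∂m = dist f g := by
        rw [dist_eq_norm, L1.norm_eq_integral_norm]
        refine MeasureTheory.integral_congr_ae ?_
        filter_upwards [Lp.coeFn_sub f g] with t ht
        rw [ht]
      rw [h2]
      gcongr
      exact le_abs_self _
  · intro f g hfg hf h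
    have hgi := hf.congr hfg
    have h1 := hDadd (g - f) f (hgi.sub hf) hf
    rw [sub_add_cancel, h, add_zero] at h1
    rw [h1, ← norm_le_zero_iff]
    refine (hDbound _ (hgi.sub hf)).trans_eq ?_
    have h2 : ∫ t, ‖(g - f) t‖ ∂m = 0 := by
      refine MeasureTheory.integral_eq_zero_of_ae ?_
      filter_upwards [hfg] with t ht
      simp [ht]
    rw [h2, mul_zero]

/-- The image of a vector measure under a continuous linear map. -/
def mapCLM (μ : VectorMeasure α Y) (T : Y →L[ℂ] X) : VectorMeasure α X :=
  μ.mapRange T.toLinearMap.toAddMonoidHom T.continuous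

@[simp] theorem mapCLM_apply (μ : VectorMeasure α Y) (T : Y →L[ℂ] X) (s : Set α) :
    μ.mapCLM T s = T (μ s) := rfl

theorem variation_mapCLM_le (μ : VectorMeasure α Y) (T : Y →L[ℂ] X) :
    (μ.mapCLM T).variation ≤ ‖T‖₊ • μ.variation := by
  refine variation_le_of_forall_enorm_le fun s _ => ?_
  rw [mapCLM_apply, Measure.smul_apply]
  refine (T.le_opENorm _).trans ?_
  change _ ≤ (‖T‖₊ : ℝ≥0∞) * _
  gcongr
  · exact le_rfl
  · exact enorm_measure_le_variation _ _

/-- Both sides are additive and `L¹(|μ|)`-bounded, and they agree on indicators. -/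
theorem integral_mapCLM [CompleteSpace X] [CompleteSpace Y] (μ : VectorMeasure α Y)
    [IsFiniteMeasure μ.variation] (T : Y →L[ℂ] X) {g : α → ℂ} (hg : μ.Integrable g) :
    (μ.mapCLM T).integral g (ContinuousLinearMap.lsmul ℝ ℂ) =
      T (μ.integral g (ContinuousLinearMap.lsmul ℝ ℂ)) := by
  refine integral_lsmul_eq_of_additive (m := μ.variation) (variation_mapCLM_le μ T)
    (Ψ := fun g => T (μ.integral g (ContinuousLinearMap.lsmul ℝ ℂ)))
    (K := ‖T‖ * ‖(ContinuousLinearMap.lsmul ℝ ℂ : ℂ →L[ℝ] Y →L[ℝ] Y)‖) ?_ ?_ ?_ hg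
  · intro f g hf hg
    rw [VectorMeasure.integral_add hf hg, _root_.map_add]
  · intro s hs z
    rw [VectorMeasure.integral_indicator_const z hs]
    simp
  · intro g _
    rw [mul_assoc]
    exact (T.le_opNorm _).trans (by gcongr; exact VectorMeasure.norm_integral_le_integral_norm)

/-- The comparison takes place in `L¹` of the variation `‖f‖ m`: the integrand `g` need not be
integrable for `m` itself. -/
theorem integral_withDensityᵥ [CompleteSpace X] {m : Measure α} {f : α → X} (hf : Integrable f m)
    {g : α → ℂ} (hg : (m.withDensityᵥ f).Integrable g) :
    (m.withDensityᵥ f).integral g (ContinuousLinearMap.lsmul ℝ ℂ) = ∫ t, g t • f t ∂m := by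
  have hvar := Measure.variation_withDensityᵥ hf
  set M := m.withDensity (fun x => ‖f x‖ₑ) with hM
  have hfin : IsFiniteMeasure M := ⟨by simpa [hM] using! hf.2⟩
  have hflt : ∀ᵐ x ∂m, ‖f x‖ₑ < ∞ := .of_forall fun x => enorm_lt_top
  have hint : ∀ g : α → ℂ, Integrable g M → Integrable (fun t => g t • f t) m := by
    intro g hg
    rw [hM, integrable_withDensity_iff_integrable_smul₀' hf.1.enorm hflt] at hg
    simp only [toReal_enorm] at hg
    -- Integrability for `‖f‖ m` only controls `‖f‖ g`, so `f` is split into its norm and its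
    -- direction; where `f` vanishes both sides are zero.
    have h1 : (fun t => g t • f t) = fun t => (‖f t‖ • g t) • (‖f t‖⁻¹ • f t) := by
      funext t
      rcases eq_or_ne (f t) 0 with h | h
      · simp [h]
      · rw [smul_comm, smul_assoc, smul_smul, inv_mul_cancel₀ (norm_ne_zero_iff.2 h), one_smul]
    rw [h1]
    refine hg.norm.mono' (hg.1.smul (hf.1.norm.inv₀.smul hf.1)) (.of_forall fun t => ?_)
    rw [norm_smul]
    refine mul_le_of_le_one_right (norm_nonneg _) ?_
    simp [norm_smul, inv_mul_le_one]
  rw [VectorMeasure.Integrable, hvar] at hg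
  refine integral_lsmul_eq_of_additive (m := M) (c := 1) (by rw [hvar, one_smul])
    (Ψ := fun g => ∫ t, g t • f t ∂m) (K := 1) ?_ ?_ ?_ hg
  · intro g h hg hh
    simp only [Pi.add_apply, add_smul]
    exact MeasureTheory.integral_add (hint g hg) (hint h hh)
  · intro s hs z
    rw [withDensityᵥ_apply hf hs, ← MeasureTheory.integral_smul, ← MeasureTheory.integral_indicator hs]
    congr with t
    by_cases ht : t ∈ s <;> simp [ht]
  · intro g hg
    rw [one_mul, hM, integral_withDensity_eq_integral_toReal_smul₀ hf.1.enorm hflt]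
    refine (MeasureTheory.norm_integral_le_integral_norm _).trans_eq ?_
    simp [norm_smul, mul_comm]

omit [NormedSpace ℂ X] in
theorem variation_absolutelyContinuous {μ : VectorMeasure α X} {m : Measure α}
    (h : μ ≪ᵥ m.toENNRealVectorMeasure) : μ.variation ≪ m := by
  refine Measure.AbsolutelyContinuous.mk fun s hs h0 => ?_
  rw [variation_apply_eq_zero hs]
  intro t hts ht
  refine h ?_
  rw [Measure.toENNRealVectorMeasure_apply_measurable ht]
  exact measure_mono_null hts h0

omit [NormedSpace ℂ X] in
theorem absolutelyContinuous_of_variation {μ : VectorMeasure α X} {m : Measure α}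
    (h : μ.variation ≪ m) : μ ≪ᵥ m.toENNRealVectorMeasure := by
  refine AbsolutelyContinuous.mk fun s hs h0 => ?_
  rw [Measure.toENNRealVectorMeasure_apply_measurable hs] at h0
  exact (variation_apply_eq_zero hs).1 (h h0) s subset_rfl hs

end MeasureTheory.VectorMeasure

/-! ### Fourier coefficients of image measures, and the properties in terms of densities -/

namespace LambdaRNP

variable {G : Type*} [CommGroup G] [TopologicalSpace G] [IsTopologicalGroup G] [CompactSpace G]
  [MeasurableSpace G] [BorelSpace G] {X : Type*} [NormedAddCommGroup X] [NormedSpace ℂ X]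
  {Y : Type*} [NormedAddCommGroup Y] [NormedSpace ℂ Y]

omit [IsTopologicalGroup G] [CompactSpace G] in
theorem integrable_conj_char (m : Measure G) [IsFiniteMeasure m] (γ : PontryaginDual G) :
    Integrable (fun t => conj (γ t : ℂ)) m :=
  .of_bound (by simp only [conj_coe_char]; exact (continuous_coe_char _).aestronglyMeasurable) 1
    (.of_forall fun t => by simp [Circle.norm_coe])

omit [CommGroup G] [TopologicalSpace G] [IsTopologicalGroup G] [CompactSpace G] [BorelSpace G]
  [NormedSpace ℂ X] in
theorem isFiniteMeasure_variation {μ : VectorMeasure G X} (h : μ ∈ M G X) :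
    IsFiniteMeasure μ.variation := ⟨h⟩

theorem isFiniteMeasure_variation_withDensityᵥ [CompleteSpace X] {f : G → X}
    (hf : Integrable f (haar G)) : IsFiniteMeasure ((haar G).withDensityᵥ f).variation := by
  rw [Measure.variation_withDensityᵥ hf]
  exact ⟨by simpa using! hf.2⟩

theorem fourierMeas_withDensityᵥ [CompleteSpace X] {f : G → X} (hf : Integrable f (haar G))
    (γ : PontryaginDual G) : fourierMeas ((haar G).withDensityᵥ f) γ = fourierFun f γ := by
  have := isFiniteMeasure_variation_withDensityᵥ hf
  exact VectorMeasure.integral_withDensityᵥ hf (integrable_conj_char _ γ)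

omit [IsTopologicalGroup G] [CompactSpace G] in
theorem fourierMeas_mapCLM [CompleteSpace X] [CompleteSpace Y] {μ : VectorMeasure G Y}
    (hμ : μ ∈ M G Y) (T : Y →L[ℂ] X) (γ : PontryaginDual G) :
    fourierMeas (μ.mapCLM T) γ = T (fourierMeas μ γ) := by
  have := isFiniteMeasure_variation hμ
  exact μ.integral_mapCLM T (integrable_conj_char _ γ)

omit [CommGroup G] [TopologicalSpace G] [IsTopologicalGroup G] [CompactSpace G] [BorelSpace G] in
theorem mapCLM_mem_M {μ : VectorMeasure G Y} (hμ : μ ∈ M G Y) (T : Y →L[ℂ] X) :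
    μ.mapCLM T ∈ M G X := by
  have := isFiniteMeasure_variation hμ
  have := isFiniteMeasure_of_le _ (μ.variation_mapCLM_le T)
  exact measure_lt_top _ _

theorem mapCLM_mem_MInftySpec [CompleteSpace X] [CompleteSpace Y] {Λ : Set (PontryaginDual G)}
    {μ : VectorMeasure G Y} (hμ : μ ∈ MInftySpec Y Λ) (T : Y →L[ℂ] X) :
    μ.mapCLM T ∈ MInftySpec X Λ := by
  obtain ⟨⟨hM, C, hC, hle⟩, hΛ⟩ := hμ
  -- The added `1` keeps the constant strictly positive when `T = 0`.
  refine ⟨⟨mapCLM_mem_M hM T, (‖T‖₊ + 1) * C, by positivity, ?_⟩, fun γ hγ => ?_⟩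
  · refine (μ.variation_mapCLM_le T).trans ?_
    rw [mul_smul]
    gcongr
    exact le_self_add
  · rw [fourierMeas_mapCLM hM, hΛ γ hγ, map_zero]

theorem mapCLM_mem_MSpecAC [CompleteSpace X] [CompleteSpace Y] {Λ : Set (PontryaginDual G)}
    {μ : VectorMeasure G Y} (hμ : μ ∈ MSpecAC Y Λ) (T : Y →L[ℂ] X) :
    μ.mapCLM T ∈ MSpecAC X Λ := by
  obtain ⟨⟨hM, hΛ⟩, hac⟩ := hμ
  refine ⟨⟨mapCLM_mem_M hM T, fun γ hγ => ?_⟩, fun s hs => ?_⟩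
  · rw [fourierMeas_mapCLM hM, hΛ γ hγ, map_zero]
  · rw [VectorMeasure.mapCLM_apply, hac hs, map_zero]

/-- Measures in `M_Λ^∞` are absolutely continuous. -/
theorem MInftySpec_subset_MSpecAC (Λ : Set (PontryaginDual G)) :
    MInftySpec X Λ ⊆ MSpecAC X Λ := by
  rintro μ ⟨⟨hM, C, -, hle⟩, hΛ⟩
  exact ⟨⟨hM, hΛ⟩, VectorMeasure.absolutelyContinuous_of_variation
    (Measure.absolutelyContinuous_of_le_smul hle)⟩

/-- A measure has a density if it is given by a Bochner integrable function. -/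
def HasDensity (μ : VectorMeasure G X) : Prop :=
  ∃ f : G → X, Integrable f (haar G) ∧ (haar G).withDensityᵥ f = μ

/-- The norm of a density is bounded by the density of the variation. -/
theorem enorm_le_of_variation_le [CompleteSpace X] {f : G → X} (hf : Integrable f (haar G))
    {h : G → ℝ≥0∞} (hle : ((haar G).withDensityᵥ f).variation ≤ (haar G).withDensity h) :
    ∀ᵐ t ∂(haar G), ‖f t‖ₑ ≤ h t := by
  rw [Measure.variation_withDensityᵥ hf] at hle
  refine ae_le_of_forall_setLIntegral_le_of_sigmaFinite₀ hf.1.enorm fun s hs _ => ?_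
  rw [← withDensity_apply _ hs, ← withDensity_apply _ hs]
  exact hle s

/-- Since `f dλ` has variation `‖f‖ λ` and the Fourier coefficients of `f`, boundedness and spectrum
transfer automatically; only existence of an integrable density is at stake. -/
theorem typeIRNP_iff [CompleteSpace X] (Λ : Set (PontryaginDual G)) :
    TypeIRNP X Λ ↔ ∀ μ ∈ MInftySpec X Λ, HasDensity μ := by
  constructor
  · intro h μ hμ
    rw [TypeIRNP] at h
    rw [h] at hμ
    obtain ⟨f, ⟨hf, -⟩, rfl⟩ := hμ
    exact ⟨f, hf.integrable le_top, rfl⟩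
  · intro h
    refine Set.Subset.antisymm (fun μ hμ => ?_) ?_
    · obtain ⟨f, hf, rfl⟩ := h μ hμ
      obtain ⟨⟨hM, C, hC, hle⟩, hΛ⟩ := hμ
      refine ⟨f, ⟨memLp_top_of_bound hf.1 C ?_, fun γ hγ => ?_⟩, rfl⟩
      · have h1 : (C • haar G) = (haar G).withDensity fun _ => (C : ℝ≥0∞) := by
          rw [withDensity_const]; rfl
        rw [h1] at hle
        filter_upwards [enorm_le_of_variation_le hf hle] with t ht
        rw [enorm_eq_nnnorm, ENNReal.coe_le_coe] at ht
        exact_mod_cast ht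
      · rw [← fourierMeas_withDensityᵥ hf, hΛ γ hγ]
    · rintro _ ⟨f, ⟨hf, hΛ⟩, rfl⟩
      have hfi := hf.integrable le_top
      have := isFiniteMeasure_variation_withDensityᵥ hfi
      refine ⟨⟨measure_lt_top _ _, (eLpNormEssSup f (haar G)).toNNReal + 1, by positivity, ?_⟩,
        fun γ hγ => ?_⟩
      · have hfin : eLpNormEssSup f (haar G) ≠ ∞ := by
          have := hf.2.ne
          rwa [eLpNorm_exponent_top] at this
        simp only
        rw [Measure.variation_withDensityᵥ hfi]
        have h1 : (((eLpNormEssSup f (haar G)).toNNReal + 1) • haar G) =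
            (haar G).withDensity fun _ => eLpNormEssSup f (haar G) + 1 := by
          rw [withDensity_const]
          ext s _
          rw [Measure.smul_apply, Measure.smul_apply, ENNReal.smul_def]
          simp [ENNReal.coe_toNNReal hfin]
        rw [h1]
        refine withDensity_mono ?_
        filter_upwards [enorm_ae_le_eLpNormEssSup f (haar G)] with t ht
        exact ht.trans le_self_add
      · simp only
        rw [fourierMeas_withDensityᵥ hfi, hΛ γ hγ]

theorem typeIIRNP_iff [CompleteSpace X] (Λ : Set (PontryaginDual G)) :
    TypeIIRNP X Λ ↔ ∀ μ ∈ MSpecAC X Λ, HasDensity μ := by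
  constructor
  · intro h μ hμ
    rw [TypeIIRNP] at h
    rw [h] at hμ
    obtain ⟨f, ⟨hf, -⟩, rfl⟩ := hμ
    exact ⟨f, memLp_one_iff_integrable.1 hf, rfl⟩
  · intro h
    refine Set.Subset.antisymm (fun μ hμ => ?_) ?_
    · obtain ⟨f, hf, rfl⟩ := h μ hμ
      refine ⟨f, ⟨memLp_one_iff_integrable.2 hf, fun γ hγ => ?_⟩, rfl⟩
      rw [← fourierMeas_withDensityᵥ hf, hμ.1.2 γ hγ]
    · rintro _ ⟨f, ⟨hf, hΛ⟩, rfl⟩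
      have hfi := memLp_one_iff_integrable.1 hf
      have := isFiniteMeasure_variation_withDensityᵥ hfi
      refine ⟨⟨measure_lt_top _ _, fun γ hγ => ?_⟩,
        VectorMeasure.absolutelyContinuous_of_variation ?_⟩
      · simp only
        rw [fourierMeas_withDensityᵥ hfi, hΛ γ hγ]
      · simp only
        rw [Measure.variation_withDensityᵥ hfi]
        exact withDensity_absolutelyContinuous _ _

end LambdaRNP

/-! ### Coordinates and truncations of weakly unconditionally Cauchy series -/

namespace WUCSeries

variable {X : Type*} [NormedAddCommGroup X] [NormedSpace ℂ X]

/-- A sequence with a weakly unconditionally Cauchy series, as an element of `ℓ¹[X]`. -/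
def ofMem (x : ℕ → X) (hx : x ∈ wucSubmodule X) : WUCSeries X := (⟨x, hx⟩ : wucSubmodule X)

@[simp] theorem ofMem_apply (x : ℕ → X) (hx : x ∈ wucSubmodule X) (n : ℕ) :
    ofMem x hx n = x n := rfl

theorem sum_le_norm (x : WUCSeries X) (s : Finset ℕ) {f : StrongDual ℂ X} (hf : ‖f‖ ≤ 1) :
    ∑ n ∈ s, ‖f (x n)‖ ≤ ‖x‖ :=
  ((x.summable f).sum_le_tsum s (fun _ _ => norm_nonneg _)).trans (x.tsum_le_norm f hf)

/-- Test against a functional norming the sum: the coefficients then come out of `∑ ‖f (x n)‖`. -/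
theorem norm_sum_smul_le (x : WUCSeries X) (s : Finset ℕ) {b : ℕ → ℂ} {B : ℝ} (hB : 0 ≤ B)
    (hb : ∀ n ∈ s, ‖b n‖ ≤ B) : ‖∑ n ∈ s, b n • x n‖ ≤ B * ‖x‖ := by
  obtain ⟨f, hf, hfx⟩ := exists_dual_vector'' ℂ (∑ n ∈ s, b n • x n)
  have h1 : ‖f (∑ n ∈ s, b n • x n)‖ = ‖∑ n ∈ s, b n • x n‖ := by
    rw [hfx]; simp
  rw [← h1, map_sum]
  calc ‖∑ n ∈ s, f (b n • x n)‖ ≤ ∑ n ∈ s, ‖f (b n • x n)‖ := norm_sum_le _ _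
    _ ≤ ∑ n ∈ s, B * ‖f (x n)‖ := by
        refine Finset.sum_le_sum fun n hn => ?_
        rw [map_smul, norm_smul]
        gcongr
        exact hb n hn
    _ = B * ∑ n ∈ s, ‖f (x n)‖ := (Finset.mul_sum _ _ _).symm
    _ ≤ B * ‖x‖ := by gcongr; exact x.sum_le_norm s hf

/-- The `n`-th coordinate of a series. -/
def coord (n : ℕ) : WUCSeries X →L[ℂ] X :=
  LinearMap.mkContinuous ⟨⟨fun x => x n, fun _ _ => rfl⟩, fun _ _ => rfl⟩ 1
    fun x => (x.norm_apply_le n).trans_eq (one_mul _).symm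

@[simp] theorem coord_apply (n : ℕ) (x : WUCSeries X) : coord n x = x n := rfl

/-- A finite combination of the terms of a series. -/
def combination (N : ℕ) (a : ℕ → ℂ) : WUCSeries X →L[ℂ] X :=
  ∑ n ∈ Finset.range N, a n • coord n

@[simp] theorem combination_apply (N : ℕ) (a : ℕ → ℂ) (x : WUCSeries X) :
    combination N a x = ∑ n ∈ Finset.range N, a n • x n := by
  simp [combination]

theorem norm_combination_le (N : ℕ) {a : ℕ → ℂ} (ha : ∀ n, ‖a n‖ ≤ 1) :
    ‖(combination N a : WUCSeries X →L[ℂ] X)‖ ≤ 1 := by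
  refine ContinuousLinearMap.opNorm_le_bound _ zero_le_one fun x => ?_
  rw [combination_apply]
  exact x.norm_sum_smul_le _ zero_le_one fun n _ => ha n

/-- Choosing `a n` to be the phase that makes `a n * f (x n)` nonnegative turns the sum of moduli
into one value of `f`. -/
theorem sum_norm_le_of_norm_combination_le {x : ℕ → X} {s : Finset ℕ} {C : ℝ}
    (h : ∀ a : ℕ → ℂ, (∀ n, ‖a n‖ ≤ 1) → ‖∑ n ∈ s, a n • x n‖ ≤ C) (f : StrongDual ℂ X) :
    ∑ n ∈ s, ‖f (x n)‖ ≤ C * ‖f‖ := by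
  choose a ha ha' using fun n => RCLike.exists_norm_eq_mul_self (f (x n))
  have h1 : ((∑ n ∈ s, ‖f (x n)‖ : ℝ) : ℂ) = f (∑ n ∈ s, a n • x n) := by
    rw [map_sum, Complex.ofReal_sum]
    refine Finset.sum_congr rfl fun n _ => ?_
    rw [map_smul, smul_eq_mul]
    exact ha' n
  have h2 : ∑ n ∈ s, ‖f (x n)‖ = ‖f (∑ n ∈ s, a n • x n)‖ := by
    rw [← h1, Complex.norm_real, Real.norm_of_nonneg (Finset.sum_nonneg fun _ _ => norm_nonneg _)]
  rw [h2, mul_comm]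
  refine (f.le_opNorm _).trans ?_
  gcongr
  exact h a fun n => (ha n).le

/-- A sequence whose finite combinations with coefficients in the unit disc are bounded by `C`
is a weakly unconditionally Cauchy series. -/
theorem mem_wucSubmodule_of_bound {x : ℕ → X} {C : ℝ}
    (h : ∀ N, ∀ a : ℕ → ℂ, (∀ n, ‖a n‖ ≤ 1) → ‖∑ n ∈ Finset.range N, a n • x n‖ ≤ C) :
    x ∈ wucSubmodule X := fun f =>
  summable_of_sum_range_le (fun _ => norm_nonneg _)
    fun N => sum_norm_le_of_norm_combination_le (h N) f

theorem norm_le_of_bound {x : WUCSeries X} {C : ℝ}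
    (h : ∀ N, ∀ a : ℕ → ℂ, (∀ n, ‖a n‖ ≤ 1) → ‖∑ n ∈ Finset.range N, a n • x n‖ ≤ C) :
    ‖x‖ ≤ C := by
  have hC : 0 ≤ C := (norm_nonneg _).trans (h 0 0 (by simp))
  refine norm_le fun f hf => Real.tsum_le_of_sum_range_le (fun _ => norm_nonneg _) fun N => ?_
  exact (sum_norm_le_of_norm_combination_le (h N) f).trans (mul_le_of_le_one_right hC hf)

theorem single_mem (n : ℕ) (x : X) : (Pi.single n x : ℕ → X) ∈ wucSubmodule X := fun f =>
  summable_of_ne_finset_zero (s := {n}) fun m hm => by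
    rw [Pi.single_eq_of_ne (by simpa using hm), map_zero, norm_zero]

/-- The series with the single nonzero term `x` in place `n`. -/
def single (n : ℕ) : X →L[ℂ] WUCSeries X :=
  LinearMap.mkContinuous
    { toFun := fun x => ofMem (Pi.single n x) (single_mem n x)
      map_add' := fun x y => WUCSeries.ext fun m => by
        simp only [add_apply, ofMem_apply, Pi.single_add, Pi.add_apply]
      map_smul' := fun c x => WUCSeries.ext fun m => by
        simp only [smul_apply, ofMem_apply, Pi.single_smul, Pi.smul_apply, RingHom.id_apply] } 1
    fun x => by
      refine norm_le fun f hf => ?_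
      have : ∑' m, ‖f (ofMem (Pi.single n x) (single_mem n x) m)‖ = ‖f x‖ := by
        rw [tsum_eq_single n]
        · simp
        · intro m hm
          simp [Pi.single_eq_of_ne hm]
      exact this.trans_le (f.le_of_opNorm_le hf x)

@[simp] theorem single_apply (n : ℕ) (x : X) (m : ℕ) :
    single n x m = (Pi.single n x : ℕ → X) m := rfl

/-- The first `N` terms of a series. -/
def truncate (N : ℕ) (x : ℕ → X) : WUCSeries X := ∑ n ∈ Finset.range N, single n (x n)

theorem truncate_apply (N : ℕ) (x : ℕ → X) (m : ℕ) :
    truncate N x m = if m < N then x m else 0 := by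
  have h : truncate N x m = ∑ n ∈ Finset.range N, (Pi.single n (x n) : ℕ → X) m :=
    map_sum (coord m) _ _
  rw [h]
  simp [Pi.single_apply]

variable (X) in
/-- All weakly unconditionally Cauchy series in `X` have terms tending to zero. -/
def TermsTendToZero : Prop :=
  ∀ x : WUCSeries X, Filter.Tendsto (fun n => x n) Filter.atTop (nhds 0)

/-- If the terms of all weakly unconditionally Cauchy series tend to zero, then such series have
uniformly small tails. -/
theorem exists_tail_le (hX : TermsTendToZero X) (x : WUCSeries X) {ε : ℝ} (hε : 0 < ε) :
    ∃ N, ∀ M, ∀ f : StrongDual ℂ X, ‖f‖ ≤ 1 → ∑ n ∈ Finset.Ico N M, ‖f (x n)‖ ≤ ε := by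
  by_contra! h
  have h' : ∀ N, ∃ M, ∃ a : ℕ → ℂ, N ≤ M ∧ (∀ n, ‖a n‖ ≤ 1) ∧
      ε < ‖∑ n ∈ Finset.Ico N M, a n • x n‖ := by
    intro N
    obtain ⟨M, f, hf, hM⟩ := h N
    have hNM : N ≤ M := by
      by_contra! hlt
      rw [Finset.Ico_eq_empty_of_le hlt.le, Finset.sum_empty] at hM
      exact absurd hM hε.not_gt
    by_contra! hb
    have := sum_norm_le_of_norm_combination_le (fun a ha => hb M a hNM ha) f
    exact absurd (this.trans (mul_le_of_le_one_right hε.le hf)) hM.not_ge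
  choose M a hM ha hMa using h'
  -- Gliding hump: consecutive blocks each carry a combination of norm above `ε`, and these
  -- combinations again form a weakly unconditionally Cauchy series, whose terms cannot tend to
  -- zero.
  let s : ℕ → ℕ := fun k => M^[k] 0
  have hs : ∀ k, s (k + 1) = M (s k) := fun k => Function.iterate_succ_apply' M k 0
  let y : ℕ → X := fun k => ∑ n ∈ Finset.Ico (s k) (s (k + 1)), a (s k) n • x n
  have hsum : ∀ f : StrongDual ℂ X, ∀ K,
      ∑ k ∈ Finset.range K, ‖f (y k)‖ ≤ ∑ n ∈ Finset.range (s K), ‖f (x n)‖ := by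
    intro f K
    induction K with
    | zero => simp [s]
    | succ K ih =>
      have hle : s K ≤ s (K + 1) := by rw [hs]; exact hM _
      rw [Finset.sum_range_succ, ← Finset.sum_range_add_sum_Ico _ hle]
      refine add_le_add ih ?_
      simp only [y, map_sum, map_smul]
      refine (norm_sum_le _ _).trans (Finset.sum_le_sum fun n _ => ?_)
      rw [norm_smul]
      exact mul_le_of_le_one_left (norm_nonneg _) (ha _ _)
  have hy : y ∈ wucSubmodule X := fun f =>
    summable_of_sum_range_le (fun _ => norm_nonneg _) fun K =>
      (hsum f K).trans ((x.summable f).sum_le_tsum _ (fun _ _ => norm_nonneg _))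
  have hlim := (hX (ofMem y hy)).norm
  simp only [ofMem_apply, norm_zero] at hlim
  obtain ⟨k, hk⟩ := (hlim.eventually_lt_const hε).exists
  have := hMa (s k)
  rw [← hs] at this
  exact absurd this hk.not_gt

/-- The error is a tail of `x`, small uniformly over the dual unit ball. -/
theorem tendsto_truncate (hX : TermsTendToZero X) (x : WUCSeries X) :
    Filter.Tendsto (fun N => truncate N x) Filter.atTop (nhds x) := by
  rw [Metric.tendsto_atTop]
  intro ε hε
  obtain ⟨N, hN⟩ := exists_tail_le hX x (half_pos hε)
  refine ⟨N, fun K hK => ?_⟩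
  rw [dist_eq_norm]
  refine lt_of_le_of_lt (norm_le fun f hf => ?_) (half_lt_self hε)
  refine Real.tsum_le_of_sum_range_le (fun _ => norm_nonneg _) fun m => ?_
  refine le_trans ?_ (hN m f hf)
  rw [← Finset.sum_filter_add_sum_filter_not (Finset.range m) (· < K)]
  have h1 : ∑ n ∈ Finset.range m with n < K, ‖f ((truncate K x - x) n)‖ = 0 := by
    refine Finset.sum_eq_zero fun n hn => ?_
    simp [truncate_apply, (Finset.mem_filter.1 hn).2]
  rw [h1, zero_add]
  have h2 : ∑ n ∈ Finset.range m with ¬ n < K, ‖f ((truncate K x - x) n)‖ =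
      ∑ n ∈ Finset.range m with ¬ n < K, ‖f (x n)‖ := by
    refine Finset.sum_congr rfl fun n hn => ?_
    simp [truncate_apply, (Finset.mem_filter.1 hn).2]
  rw [h2]
  refine Finset.sum_le_sum_of_subset_of_nonneg (fun n hn => ?_) fun _ _ _ => norm_nonneg _
  rw [Finset.mem_filter, Finset.mem_range] at hn
  rw [Finset.mem_Ico]
  omega

end WUCSeries

/-! ### Assembling a density from the coordinates -/

namespace LambdaRNP

variable {G : Type*} [CommGroup G] [TopologicalSpace G] [IsTopologicalGroup G] [CompactSpace G]
  [MeasurableSpace G] [BorelSpace G] {X : Type*} [NormedAddCommGroup X] [NormedSpace ℂ X]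
  [CompleteSpace X]

open WUCSeries

/-- A function is a density of a measure in `ℓ¹[X]` as soon as it is so in each coordinate. -/
theorem withDensityᵥ_eq_of_coord {μ : VectorMeasure G (WUCSeries X)} {f : G → WUCSeries X}
    (hf : Integrable f (haar G)) {F : ℕ → G → X} (hF : ∀ n, Integrable (F n) (haar G))
    (hFμ : ∀ n, (haar G).withDensityᵥ (F n) = μ.mapCLM (coord n))
    (hfF : ∀ n, ∀ᵐ t ∂(haar G), f t n = F n t) : (haar G).withDensityᵥ f = μ := by
  ext s hs n
  rw [withDensityᵥ_apply hf hs, ← coord_apply, ← coord_apply n (μ s),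
    ← VectorMeasure.mapCLM_apply, ← hFμ, withDensityᵥ_apply (hF n) hs,
    ← (coord n).integral_comp_comm hf.restrict]
  exact integral_congr_ae (ae_restrict_of_ae (hfF n))

/-- If all weakly unconditionally Cauchy series in `X` have terms tending to zero, then an
absolutely continuous measure in `ℓ¹[X]` whose coordinates have densities has a density. -/
theorem hasDensity_of_termsTendToZero (hX : TermsTendToZero X)
    {μ : VectorMeasure G (WUCSeries X)} (hM : μ ∈ M G (WUCSeries X))
    (hac : μ.variation ≪ haar G) (h : ∀ n, HasDensity (μ.mapCLM (coord n))) : HasDensity μ := by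
  choose F hF hFμ using h
  have := isFiniteMeasure_variation hM
  set r := μ.variation.rnDeriv (haar G) with hr
  have hrμ : (haar G).withDensity r = μ.variation := Measure.withDensity_rnDeriv_eq _ _ hac
  have hrfin : ∀ᵐ t ∂(haar G), r t < ∞ := Measure.rnDeriv_lt_top _ _
  -- The combination is the density of the image of `μ` under the contraction `combination N a`; the
  -- null set still depends on `a`.
  have hcomb : ∀ N, ∀ a : ℕ → ℂ, (∀ n, ‖a n‖ ≤ 1) →
      ∀ᵐ t ∂(haar G), ‖∑ n ∈ Finset.range N, a n • F n t‖ₑ ≤ r t := by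
    intro N a ha
    have hint : Integrable (fun t => ∑ n ∈ Finset.range N, a n • F n t) (haar G) :=
      integrable_finsetSum _ fun n _ => (hF n).smul (a n)
    refine enorm_le_of_variation_le hint ?_
    have heq : (haar G).withDensityᵥ (fun t => ∑ n ∈ Finset.range N, a n • F n t) =
        μ.mapCLM (combination N a) := by
      ext s hs
      rw [withDensityᵥ_apply hint hs,
        integral_finsetSum (f := fun n t => a n • F n t) _
          fun n _ => ((hF n).smul (a n)).restrict, VectorMeasure.mapCLM_apply, combination_apply]
      refine Finset.sum_congr rfl fun n _ => ?_
      rw [integral_smul, ← withDensityᵥ_apply (hF n) hs, hFμ]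
      rfl
    rw [heq, hrμ]
    refine (μ.variation_mapCLM_le _).trans ?_
    calc _ ≤ (1 : ℝ≥0) • μ.variation := by
          gcongr
          exact norm_combination_le N ha
      _ = μ.variation := one_smul _ _
  -- A dense sequence in the product of unit discs: the bound holds off one null set for all its
  -- members, and extends to every `a` because it is a closed condition.
  let D : ℕ → ℕ → Metric.closedBall (0 : ℂ) 1 := TopologicalSpace.denseSeq _
  have hae : ∀ᵐ t ∂(haar G), ∀ N k, ‖∑ n ∈ Finset.range N, (D k n : ℂ) • F n t‖ₑ ≤ r t := by
    refine ae_all_iff.2 fun N => ae_all_iff.2 fun k => hcomb N (fun n => D k n) fun n => ?_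
    exact mem_closedBall_zero_iff.1 (D k n).2
  have hbound : ∀ᵐ t ∂(haar G), ∀ N, ∀ a : ℕ → ℂ, (∀ n, ‖a n‖ ≤ 1) →
      ‖∑ n ∈ Finset.range N, a n • F n t‖ ≤ (r t).toReal := by
    filter_upwards [hae, hrfin] with t ht hrt N a ha
    have hcl : IsClosed {b : ℕ → Metric.closedBall (0 : ℂ) 1 |
        ‖∑ n ∈ Finset.range N, (b n : ℂ) • F n t‖ ≤ (r t).toReal} :=
      isClosed_le (by fun_prop) continuous_const
    have hall := closure_minimal (s := Set.range D) (by
      rintro _ ⟨k, rfl⟩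
      rw [Set.mem_ofPred_eq, ← toReal_enorm]
      exact ENNReal.toReal_mono hrt.ne (ht N k)) hcl
    rw [(TopologicalSpace.denseRange_denseSeq _).closure_range] at hall
    exact hall (Set.mem_univ fun n => ⟨a n, by simpa using ha n⟩)
  classical
  -- The value `0` is used only on a null set.
  let f : G → WUCSeries X := fun t =>
    if ht : (fun n => F n t) ∈ wucSubmodule X then ofMem _ ht else 0
  have hfF : ∀ᵐ t ∂(haar G), ∀ n, f t n = F n t := by
    filter_upwards [hbound] with t ht n
    have hmem : (fun n => F n t) ∈ wucSubmodule X := mem_wucSubmodule_of_bound ht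
    simp only [f, dif_pos hmem, ofMem_apply]
  have hfnorm : ∀ᵐ t ∂(haar G), ‖f t‖ ≤ (r t).toReal := by
    filter_upwards [hbound, hfF] with t ht hft
    refine norm_le_of_bound fun N a ha => ?_
    simp only [hft]
    exact ht N a ha
  -- Truncations take values in finitely many coordinates and are strongly measurable; the
  -- hypothesis on `X` makes them converge to `f` in norm.
  have hmeas : AEStronglyMeasurable f (haar G) := by
    refine aestronglyMeasurable_of_tendsto_ae Filter.atTop
      (f := fun N t => truncate N fun n => F n t) (fun N => ?_) ?_
    · exact (integrable_finsetSum _ fun n _ => (single n).integrable_comp (hF n)).1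
    · filter_upwards [hfF] with t ht
      have h1 := tendsto_truncate hX (f t)
      simpa only [funext ht] using h1
  have hrint : Integrable (fun t => (r t).toReal) (haar G) := by
    refine integrable_toReal_of_lintegral_ne_top (Measure.measurable_rnDeriv _ _).aemeasurable ?_
    exact (Measure.lintegral_rnDeriv_lt_top _ _).ne
  have hfi : Integrable f (haar G) := hrint.mono' hmeas hfnorm
  exact ⟨f, hfi, withDensityᵥ_eq_of_coord hfi hF hFμ fun n => by
    filter_upwards [hfF] with t ht using ht n⟩

/-- For finite `Λ`, a measure in `ℓ¹[X]` with spectrum in `Λ` whose coordinates have densities has a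
trigonometric polynomial as density. -/
theorem hasDensity_of_finite [TopologicalSpace.MetrizableSpace G] {Λ : Set (PontryaginDual G)}
    (hΛ : Λ.Finite) {μ : VectorMeasure G (WUCSeries X)} (hμ : μ ∈ MSpec (WUCSeries X) Λ)
    (h : ∀ n, HasDensity (μ.mapCLM (coord n))) : HasDensity μ := by
  classical
  choose F hF hFμ using h
  have hcont : ∀ γ : PontryaginDual G, ∀ {Z : Type _} [NormedAddCommGroup Z] [NormedSpace ℂ Z]
      (z : Z), Integrable (fun t => (γ t : ℂ) • z) (haar G) := fun γ _ _ _ z =>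
    integrable_char_smul (integrable_const z) γ
  let f : G → WUCSeries X := fun t => ∑ γ ∈ hΛ.toFinset, (γ t : ℂ) • fourierMeas μ γ
  have hf : Integrable f (haar G) := integrable_finsetSum _ fun γ _ => hcont γ _
  refine ⟨f, hf, withDensityᵥ_eq_of_coord hf hF hFμ fun n => ?_⟩
  have hfn : (fun t => f t n) =
      fun t => ∑ γ ∈ hΛ.toFinset, (γ t : ℂ) • coord n (fourierMeas μ γ) := by
    funext t
    rw [← coord_apply]
    simp only [f, map_sum, map_smul]
  have hfni : Integrable (fun t => f t n) (haar G) := (coord n).integrable_comp hf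
  -- In each coordinate the polynomial and `F n` have the same Fourier coefficients: `μ̂` on `Λ`,
  -- zero elsewhere.
  have h0 := ae_eq_zero_of_fourierFun_eq_zero (f := (fun t => f t n) - F n)
    (hfni.sub (hF n)) fun δ => ?_
  · filter_upwards [h0] with t ht
    exact sub_eq_zero.1 ht
  · rw [fourierFun_sub hfni (hF n), ← fourierMeas_withDensityᵥ (hF n), hFμ,
      fourierMeas_mapCLM hμ.1, hfn, fourierFun_sum _ _ fun γ _ => hcont γ _]
    simp only [fourierFun_char_smul, Finset.sum_ite_eq]
    split_ifs with hδ
    · exact sub_self _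
    · rw [hμ.2 δ (by simpa using hδ), map_zero, sub_zero]

end LambdaRNP

namespace LambdaRNP

variable {G : Type*} [CommGroup G] [TopologicalSpace G] [IsTopologicalGroup G] [CompactSpace G]
  [MeasurableSpace G] [BorelSpace G] {X : Type*} [NormedAddCommGroup X] [NormedSpace ℂ X]
  [CompleteSpace X]

open WUCSeries

/-! ### The measure attached to a sequence of characters and a series -/

/-- Null multipliers improve weak unconditional Cauchyness to norm summability, since a finite sum
beyond `N` is at most `‖x‖` times its largest multiplier. -/
theorem _root_.WUCSeries.summable_smul (x : WUCSeries X) {b : ℕ → ℂ}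
    (hb : Filter.Tendsto b Filter.atTop (nhds 0)) : Summable fun n => b n • x n := by
  rw [summable_iff_vanishing_norm]
  intro ε hε
  have hpos : 0 < ‖x‖ + 1 := by positivity
  obtain ⟨N, hN⟩ := Metric.tendsto_atTop.1 hb (ε / (‖x‖ + 1)) (by positivity)
  refine ⟨Finset.range N, fun t ht => ?_⟩
  have h1 := x.norm_sum_smul_le t (b := b) (B := ε / (‖x‖ + 1)) (by positivity) fun n hn => by
    have hn' : N ≤ n := by
      by_contra! hlt
      exact (Finset.disjoint_left.1 ht hn) (Finset.mem_range.2 hlt)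
    simpa using (hN n hn').le
  refine h1.trans_lt ?_
  rw [div_mul_eq_mul_div, div_lt_iff₀ hpos]
  nlinarith [norm_nonneg x]

/-- The sum of the series `x` with the Fourier coefficients of `g` along `γ` as weights. -/
def fourierSeries (γ : ℕ → PontryaginDual G) (x : WUCSeries X) (g : G → ℂ) : X :=
  ∑' n, fourierFun g (γ n)⁻¹ • x n

section

variable {γ : ℕ → PontryaginDual G} (hγ : Function.Injective γ) (x : WUCSeries X)

include hγ

/-- The inverse character undoes the conjugation, so the weights are `∫ γ n g dλ`; they tend to zero
by Riemann-Lebesgue. -/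
theorem summable_fourierSeries {g : G → ℂ} (hg : Integrable g (haar G)) :
    Summable fun n => fourierFun g (γ n)⁻¹ • x n :=
  x.summable_smul (tendsto_fourierFun_zero hg (inv_injective.comp hγ))

theorem fourierSeries_add {f g : G → ℂ} (hf : Integrable f (haar G))
    (hg : Integrable g (haar G)) :
    fourierSeries γ x (f + g) = fourierSeries γ x f + fourierSeries γ x g := by
  simp only [fourierSeries, fourierFun_add hf hg, add_smul]
  exact (summable_fourierSeries hγ x hf).tsum_add (summable_fourierSeries hγ x hg)

theorem norm_fourierSeries_le {g : G → ℂ} (hg : Integrable g (haar G)) :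
    ‖fourierSeries γ x g‖ ≤ ‖x‖ * ∫ t, ‖g t‖ ∂(haar G) := by
  refine le_of_tendsto (summable_fourierSeries hγ x hg).hasSum.norm (.of_forall fun s => ?_)
  rw [mul_comm]
  exact x.norm_sum_smul_le s (integral_nonneg fun _ => norm_nonneg _)
    fun n _ => norm_fourierFun_le g _

omit hγ [CompleteSpace X] in
theorem fourierSeries_indicator (s : Set G) (z : ℂ) :
    fourierSeries γ x (s.indicator fun _ => z) =
      z • fourierSeries γ x (s.indicator fun _ => 1) := by
  have h : ∀ δ : PontryaginDual G, fourierFun (s.indicator fun _ => z) δ =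
      z * fourierFun (s.indicator fun _ => (1 : ℂ)) δ := by
    intro δ
    rw [fourierFun, fourierFun, ← integral_const_mul]
    congr with t
    by_cases ht : t ∈ s <;> simp [ht, mul_comm]
  simp only [fourierSeries, h, mul_smul]
  exact tsum_const_smul'' z

omit hγ in
theorem integrable_indicator_one {s : Set G} (hs : MeasurableSet s) :
    Integrable (s.indicator fun _ => (1 : ℂ)) (haar G) := (integrable_const 1).indicator hs

theorem norm_fourierSeries_indicator_le {s : Set G} (hs : MeasurableSet s) :
    ‖fourierSeries γ x (s.indicator fun _ => 1)‖ ≤ ‖x‖ * (haar G).real s := by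
  refine (norm_fourierSeries_le hγ x (integrable_indicator_one hs)).trans_eq ?_
  simp only [norm_indicator_eq_indicator_norm, norm_one]
  rw [integral_indicator hs]
  simp

theorem fourierSeries_indicator_union {s t : Set G} (hs : MeasurableSet s) (ht : MeasurableSet t)
    (hst : Disjoint s t) :
    fourierSeries γ x ((s ∪ t).indicator fun _ => 1) =
      fourierSeries γ x (s.indicator fun _ => 1) + fourierSeries γ x (t.indicator fun _ => 1) := by
  rw [Set.indicator_union_of_disjoint hst]
  exact fourierSeries_add hγ x (integrable_indicator_one hs) (integrable_indicator_one ht)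

theorem fourierSeries_indicator_biUnion {f : ℕ → Set G} (hf : ∀ i, MeasurableSet (f i))
    (hd : Pairwise (Function.onFun Disjoint f)) (s : Finset ℕ) :
    fourierSeries γ x ((⋃ i ∈ s, f i).indicator fun _ => 1) =
      ∑ i ∈ s, fourierSeries γ x ((f i).indicator fun _ => 1) := by
  induction s using Finset.induction_on with
  | empty => simp [fourierSeries, fourierFun]
  | insert i s hi ih =>
    rw [Finset.set_biUnion_insert, Finset.sum_insert hi, ← ih]
    refine fourierSeries_indicator_union hγ x (hf i) (s.measurableSet_biUnion fun j _ => hf j) ?_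
    rw [Set.disjoint_iUnion₂_right]
    intro j hj
    exact hd fun hij => hi (hij ▸ hj)

/-- The remainder after finitely many sets is the value on the rest of the union, at most `‖x‖`
times its Haar measure. -/
theorem hasSum_fourierSeries_indicator {f : ℕ → Set G} (hf : ∀ i, MeasurableSet (f i))
    (hd : Pairwise (Function.onFun Disjoint f)) :
    HasSum (fun i => fourierSeries γ x ((f i).indicator fun _ => 1))
      (fourierSeries γ x ((⋃ i, f i).indicator fun _ => 1)) := by
  have hU := MeasurableSet.iUnion hf
  have h1 : HasSum (fun i => (haar G).real (f i)) ((haar G).real (⋃ i, f i)) := by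
    have := (haar G).toSignedMeasure.m_iUnion hf hd
    simpa [Measure.toSignedMeasure_apply_measurable, hf, hU] using this
  have h2 : Filter.Tendsto (fun s : Finset ℕ =>
      ‖x‖ * ((haar G).real (⋃ i, f i) - ∑ i ∈ s, (haar G).real (f i))) Filter.atTop (nhds 0) := by
    simpa using (h1.const_sub ((haar G).real (⋃ i, f i))).const_mul ‖x‖
  rw [HasSum, SummationFilter.unconditional_filter, tendsto_iff_norm_sub_tendsto_zero]
  refine squeeze_zero (fun _ => norm_nonneg _) (fun s => ?_) h2
  have hB : MeasurableSet (⋃ i ∈ s, f i) := s.measurableSet_biUnion fun j _ => hf j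
  have hsub : (⋃ i ∈ s, f i) ⊆ ⋃ i, f i := Set.iUnion₂_subset fun i _ => Set.subset_iUnion f i
  have h3 := fourierSeries_indicator_union hγ x hB (hU.diff hB) Set.disjoint_sdiff_right
  rw [Set.union_sdiff_cancel hsub] at h3
  rw [← fourierSeries_indicator_biUnion hγ x hf hd, h3, norm_sub_rev, add_sub_cancel_left]
  refine (norm_fourierSeries_indicator_le hγ x (hU.diff hB)).trans_eq ?_
  rw [measureReal_sdiff hsub hB, measureReal_biUnion_finset (fun i _ j _ hij => hd hij)
    fun i _ => hf i]

/-- The vector measure `A ↦ ∑ n, (∫_A γ n dλ) • x n`. -/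
theorem exists_vectorMeasure_fourierSeries : ∃ μ : VectorMeasure G X,
    ∀ s, MeasurableSet s → μ s = fourierSeries γ x (s.indicator fun _ => 1) := by
  classical
  refine ⟨{ measureOf' := fun s => if MeasurableSet s then
              fourierSeries γ x (s.indicator fun _ => 1) else 0
            empty' := by simp [fourierSeries, fourierFun]
            not_measurable' := fun s hs => if_neg hs
            m_iUnion' := fun f hf hd => ?_ }, fun s hs => if_pos hs⟩
  simp only [hf, MeasurableSet.iUnion hf, if_true]
  exact hasSum_fourierSeries_indicator hγ x hf hd

/-- If a sequence of characters and a series are given, some measure in `M^∞` has the terms of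
the series as Fourier coefficients at these characters, and no other nonzero ones. -/
theorem exists_mem_MInfty_fourierMeas : ∃ μ ∈ MInfty G X,
    (∀ n, fourierMeas μ (γ n) = x n) ∧ ∀ δ, δ ∉ Set.range γ → fourierMeas μ δ = 0 := by
  classical
  obtain ⟨μ, hμ⟩ := exists_vectorMeasure_fourierSeries hγ x
  have hvar : μ.variation ≤ (‖x‖₊ + 1) • haar G := by
    refine VectorMeasure.variation_le_of_forall_enorm_le fun s hs => ?_
    have h1 := norm_fourierSeries_indicator_le hγ x hs
    rw [← hμ s hs] at h1
    have h2 : ‖μ s‖ ≤ (‖x‖ + 1) * (haar G).real s :=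
      h1.trans (by gcongr; linarith)
    rw [← ofReal_norm]
    refine (ENNReal.ofReal_le_ofReal h2).trans_eq ?_
    rw [ENNReal.ofReal_mul (by positivity), ofReal_measureReal]
    rw [Measure.smul_apply, ENNReal.smul_def]
    congr 1
    rw [ENNReal.ofReal]
    congr 1
    ext
    simp
  have hfour : ∀ δ, fourierMeas μ δ = ∑' n, (if δ = γ n then (1 : ℂ) else 0) • x n := by
    intro δ
    -- The series functional has the defining properties of integration against `μ`; orthogonality
    -- of characters then leaves at most one term.
    have h1 : fourierMeas μ δ = fourierSeries γ x fun t => conj (δ t : ℂ) := by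
      refine VectorMeasure.integral_lsmul_eq_of_additive hvar
        (fun f g hf hg => fourierSeries_add hγ x hf hg) (fun s hs z => ?_)
        (fun g hg => norm_fourierSeries_le hγ x hg) (integrable_conj_char _ δ)
      rw [fourierSeries_indicator, hμ s hs]
    rw [h1, fourierSeries]
    refine tsum_congr fun n => ?_
    congr 1
    rw [← integral_conj_char_mul_char δ (γ n), fourierFun]
    congr with t
    rw [conj_coe_char (γ n)⁻¹, inv_inv, smul_eq_mul, mul_comm]
  refine ⟨μ, ⟨?_, ‖x‖₊ + 1, by positivity, hvar⟩, fun k => ?_, fun δ hδ => ?_⟩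
  · have := isFiniteMeasure_of_le _ hvar
    exact measure_lt_top _ _
  · rw [hfour, tsum_eq_single k]
    · simp
    · intro n hn
      rw [if_neg fun h => hn (hγ h).symm, zero_smul]
  · rw [hfour]
    convert tsum_zero with n
    rw [if_neg fun h => hδ ⟨n, h.symm⟩, zero_smul]

end

/-! ### Consequences of the Radon-Nikodym property of `X` -/

/-- If `X` has the type I-`Λ`-Radon-Nikodym property for an infinite `Λ`, then the terms of
weakly unconditionally Cauchy series in `X` tend to zero. -/
theorem termsTendToZero_of_typeIRNP {Λ : Set (PontryaginDual G)} (hΛ : Λ.Infinite)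
    (h : TypeIRNP X Λ) : TermsTendToZero X := by
  intro x
  let γ : ℕ → PontryaginDual G := fun n => hΛ.natEmbedding Λ n
  have hγ : Function.Injective γ := Subtype.val_injective.comp (hΛ.natEmbedding Λ).injective
  obtain ⟨μ, hμ, hx, h0⟩ := exists_mem_MInfty_fourierMeas hγ x
  obtain ⟨f, hf, rfl⟩ := (typeIRNP_iff Λ).1 h μ ⟨hμ, fun δ hδ => h0 δ fun ⟨n, hn⟩ =>
    hδ (hn ▸ (hΛ.natEmbedding Λ n).2)⟩
  -- The terms `x n` are now Fourier coefficients of an integrable function at distinct characters.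
  simp only [← hx, fourierMeas_withDensityᵥ hf]
  exact tendsto_fourierFun_zero hf hγ

/-- A measure dominated by a multiple of `λ` is absolutely continuous, and the type I property needs
only an integrable density by `typeIRNP_iff`. -/
theorem TypeIIRNP.typeIRNP {Λ : Set (PontryaginDual G)} (h : TypeIIRNP X Λ) : TypeIRNP X Λ :=
  (typeIRNP_iff Λ).2 fun μ hμ => (typeIIRNP_iff Λ).1 h μ (MInftySpec_subset_MSpecAC Λ hμ)

/-- If `X` has the type I-`Λ`-Radon-Nikodym property, then an absolutely continuous measure in
`ℓ¹[X]` with spectrum in `Λ` has a density once its coordinates do. -/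
theorem hasDensity_of_coord [TopologicalSpace.MetrizableSpace G] {Λ : Set (PontryaginDual G)}
    (hX : TypeIRNP X Λ) {μ : VectorMeasure G (WUCSeries X)} (hμ : μ ∈ MSpecAC (WUCSeries X) Λ)
    (h : ∀ n, HasDensity (μ.mapCLM (coord n))) : HasDensity μ := by
  -- A finite `Λ` supplies no sequence of distinct characters, so nothing forces terms to tend to
  -- zero and an explicit density is used.
  rcases Λ.finite_or_infinite with hΛ | hΛ
  · exact hasDensity_of_finite hΛ hμ.1 h
  · exact hasDensity_of_termsTendToZero (termsTendToZero_of_typeIRNP hΛ hX) hμ.1.1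
      (VectorMeasure.variation_absolutelyContinuous hμ.2) h

end LambdaRNP

end

theorem corollary2 {G : Type*} [CommGroup G] [TopologicalSpace G] [IsTopologicalGroup G]
    [CompactSpace G] [TopologicalSpace.MetrizableSpace G] [MeasurableSpace G] [BorelSpace G]
    (Λ : Set (PontryaginDual G))
    {X : Type*} [NormedAddCommGroup X] [NormedSpace ℂ X] [CompleteSpace X] :
    (LambdaRNP.TypeIRNP X Λ → LambdaRNP.TypeIRNP (WUCSeries X) Λ) ∧
      (LambdaRNP.TypeIIRNP X Λ → LambdaRNP.TypeIIRNP (WUCSeries X) Λ) := by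
  refine ⟨fun h => ?_, fun h => ?_⟩
  · exact (LambdaRNP.typeIRNP_iff Λ).2 fun μ hμ =>
      LambdaRNP.hasDensity_of_coord h (LambdaRNP.MInftySpec_subset_MSpecAC Λ hμ) fun n =>
        (LambdaRNP.typeIRNP_iff Λ).1 h _ (LambdaRNP.mapCLM_mem_MInftySpec hμ _)
  · exact (LambdaRNP.typeIIRNP_iff Λ).2 fun μ hμ =>
      LambdaRNP.hasDensity_of_coord h.typeIRNP hμ fun n =>
        (LambdaRNP.typeIIRNP_iff Λ).1 h _ (LambdaRNP.mapCLM_mem_MSpecAC hμ _)
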